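/- Let $E$ and $E_*$ be separable complex Hilbert spaces and let $\Phi:\mathbb D^2\to\mathcal L(E,E_*)$ belong to the Schur class $\mathcal S_2(E,E_*)$, i.e. $\Phi$ is holomorphic and $\|\Phi(z)\|\le 1$ for all $z\in\mathbb D^2$. *Positive kernels and Agler kernels.* A map $K:\mathbb D^2\times\mathbb D^2\to\mathcal L(E_*)$ is a positive kernel if $\sum_{i,j=1}^N\langle K(x_i,x_j)\eta_j,\eta_i\rangle\ge 0$ for all $N$, $x_1,\dots,x_N\in\mathbb D^2$, $\eta_1,\dots,\eta_N\in E_*$. A pair $(K_1,K_2)$ is called a pair of Agler kernels of $\Phi$ if $K_1,K_2$ are positive kernels and $$I_{E_*}-\Phi(z)\Phi(w)^*=(1-z_1\bar w_1)K_2(z,w)+(1-z_2\bar w_2)K_1(z,w)\qquad(z,w\in\mathbb D^2).$$ *Canonical kernels.* Let $L^2(E)=L^2(\mathbb T^2)\otimes E$, let $H^2(E)\subset L^2(E)$ be the Hardy space of the bidisk, let $L^2_{+-}(E)$ (resp. $L^2_{-+}(E)$) be the set of $f\in L^2(E)$ with $\hat f(n_1,n_2)=0$ unless $n_1\ge 0>n_2$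 (resp. $n_2\ge 0>n_1$), and similarly for $E_*$. Let $Z_j$ be multiplication by the $j$-th coordinate, and let $\Phi$ also denote multiplication by $\Phi$, as an operator $L^2(E)\to L^2(E_*)$. Let $\mathscr H$ be the operator range of $\begin{bmatrix} I&\Phi\\ \Phi^*&I\end{bmatrix}^{1/2}$ on $L^2(E_*)\oplus L^2(E)$, that is, the image of this operator $T$ with inner product $\langle Tx,Ty\rangle=\langle P_{(\ker T)^\perp}x,y\rangle$. Put $$\mathcal K_\Phi=\mathscr H\ominus\Big(\begin{bmatrix}\Phi\\ I\end{bmatrix}H^2(E)\oplus\begin{bmatrix}I\\ \Phi^*\end{bmatrix}\big(L^2\ominus H^2\big)(E_*)\Big)$$ and let $P_\Phi$ be the orthogonal projection of $\mathscr H$ onto $\mathcal K_\Phi$. For $j=1,2$ let $$S_j^{max}=\{u\in\mathcal K_\Phi: Z_j^ku\in\mathcal K_\Phi\ \text{for all } k\in\mathbb N\},\qquad S_1^{min}=\overline{P_\Phi\begin{bmatrix}\Phi\\ I\end{bmatrix}L^2_{+-}(E)},\qquad S_2^{min}=\overline{P_\Phi\begin{bmatrix}\Phi\\ I\end{bmatrix}L^2_{-+}(E)},$$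 and $\mathcal R=S_1^{max}\ominus S_1^{min}$. If $S$ is a closed subspace of $\mathcal K_\Phi$, then the space $H_S$ of all $f$ for which there is a $g$ with $\begin{bmatrix}f\\ g\end{bmatrix}\in S$, with norm $\|f\|_{H_S}=\min\left\{\left\|\begin{bmatrix}f\\ g\end{bmatrix}\right\|_{\mathscr H}:\begin{bmatrix}f\\ g\end{bmatrix}\in S\right\}$, is a reproducing kernel Hilbert space of $E_*$-valued functions on $\mathbb D^2$. Let $K_j^{max}$, $K_j^{min}$ and $G$ be the reproducing kernels of $H_S$ for $S=S_j^{max}\ominus Z_jS_j^{max}$, $S=S_j^{min}\ominus Z_jS_j^{min}$ and $S=\mathcal R$, respectively. **Theorem.** For $j=1,2$ and all $z,w\in\mathbb D^2$, $$G(z,w)=\frac{K_j^{max}(z,w)-K_j^{min}(z,w)}{1-z_j\bar w_j}.$$ Moreover, for all $K_1,K_2:\mathbb D^2\times\mathbb D^2\to\mathcal L(E_*)$, the pair $(K_1,K_2)$ is a pair of Agler kernels of $\Phi$ if and only if $K_1,K_2$ are positive kernels and there are positive kernels $G_1,G_2:\mathbb D^2\times\mathbb D^2\to\mathcal L(E_*)$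 such that $$K_1(z,w)=K_1^{min}(z,w)+(1-z_1\bar w_1)G_1(z,w),\qquad K_2(z,w)=K_2^{min}(z,w)+(1-z_2\bar w_2)G_2(z,w)$$ and $G=G_1+G_2$. -/

import Mathlib

noncomputable section

open MeasureTheory Set Complex
open scoped Real InnerProductSpace ComplexOrder

set_option linter.unusedSectionVars false

namespace BidiskAgler

/-- The open unit bidisk `𝔻²`. -/
def bidisk : Set (Fin 2 → ℂ) := {z | ∀ i, ‖z i‖ < 1}

section Fourier

/-- Lebesgue measure on `[0, 2π]²`. -/
def torusMeasure : Measure (Fin 2 → ℝ) := volume.restrict (Icc 0 fun _ => 2 * π)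

/-- The character `θ ↦ e^{i⟨n, θ⟩}` of the torus. -/
def character (n : Fin 2 → ℤ) (θ : Fin 2 → ℝ) : ℂ := ∏ i, exp (θ i * I) ^ n i

theorem continuous_character (n : Fin 2 → ℤ) : Continuous (character n) := by
  unfold character
  refine continuous_finsetProd _ fun i _ => ?_
  exact Continuous.zpow₀ (by fun_prop) _ fun a => Or.inl (exp_ne_zero _)

theorem norm_character (n : Fin 2 → ℤ) (θ : Fin 2 → ℝ) : ‖character n θ‖ = 1 := by
  simp [character, norm_exp_ofReal_mul_I]

theorem character_add (n m : Fin 2 → ℤ) (θ : Fin 2 → ℝ) :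
    character (n + m) θ = character n θ * character m θ := by
  simp only [character, Pi.add_apply, ← Finset.prod_mul_distrib]
  exact Finset.prod_congr rfl fun i _ => zpow_add₀ (exp_ne_zero _) _ _

theorem character_neg (n : Fin 2 → ℤ) (θ : Fin 2 → ℝ) :
    character (-n) θ = (starRingEnd ℂ) (character n θ) := by
  have h1 : character (-n) θ * character n θ = 1 := by
    rw [← character_add]; simp [character]
  have h2 : (starRingEnd ℂ) (character n θ) * character n θ = 1 := by
    rw [mul_comm, Complex.mul_conj, normSq_eq_norm_sq, norm_character]; simp
  have h3 : character n θ ≠ 0 := by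
    rw [← norm_ne_zero_iff, norm_character]; exact one_ne_zero
  exact mul_right_cancel₀ h3 (h1.trans h2.symm)

theorem integrable_torus {V : Type*} [NormedAddCommGroup V] {f : (Fin 2 → ℝ) → V}
    (hf : Continuous f) : Integrable f torusMeasure :=
  hf.continuousOn.integrableOn_compact isCompact_Icc

theorem integral_circle (k : ℤ) :
    ∫ t in Icc (0 : ℝ) (2 * π), exp (t * I) ^ k = if k = 0 then (2 * π : ℂ) else 0 := by
  rw [integral_Icc_eq_integral_Ioc, ← intervalIntegral.integral_of_le Real.two_pi_pos.le]
  split_ifs with h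
  · simp [h]
  · have : ∀ t : ℝ, exp (t * I) ^ k = exp ((k * I) * t) := fun t => by
      rw [← Complex.exp_int_mul]; ring_nf
    simp_rw [this]
    rw [integral_exp_mul_complex (by simp [h])]
    have : (k * I * ((2 * π : ℝ) : ℂ)) = k * (2 * π * I) := by push_cast; ring
    rw [this, Complex.exp_int_mul_two_pi_mul_I]
    simp

theorem integral_character (n : Fin 2 → ℤ) :
    ∫ θ, character n θ ∂torusMeasure = if n = 0 then (2 * π : ℂ) ^ 2 else 0 := by
  have h : torusMeasure = Measure.pi fun _ : Fin 2 => (volume : Measure ℝ).restrict (Icc 0 (2 * π)) := by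
    rw [torusMeasure, volume_pi, ← Measure.restrict_pi_pi, pi_univ_Icc]; rfl
  rw [h]
  unfold character
  rw [integral_fintype_prod_eq_prod (fun i (t : ℝ) => exp (t * I) ^ n i)]
  simp only [integral_circle, Fin.prod_univ_two, funext_iff, Fin.forall_fin_two, Pi.zero_apply]
  by_cases h0 : n 0 = 0 <;> by_cases h1 : n 1 = 0 <;> simp [h0, h1, sq]

variable {V : Type*} [NormedAddCommGroup V] [InnerProductSpace ℂ V] [CompleteSpace V]

theorem integral_norm_sq_trigPoly (S : Finset (Fin 2 → ℤ)) (c : (Fin 2 → ℤ) → V) :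
    ∫ θ, ‖∑ m ∈ S, character m θ • c m‖ ^ 2 ∂torusMeasure
      = (2 * π) ^ 2 * ∑ m ∈ S, ‖c m‖ ^ 2 := by
  have key : ∀ θ, ((‖∑ m ∈ S, character m θ • c m‖ ^ 2 : ℝ) : ℂ)
      = ∑ m ∈ S, ∑ l ∈ S, character (l - m) θ * inner ℂ (c m) (c l) := fun θ => by
    have := inner_self_eq_norm_sq_to_K (𝕜 := ℂ) (∑ m ∈ S, character m θ • c m)
    push_cast
    refine Eq.trans this.symm ?_
    simp only [sum_inner, inner_sum, inner_smul_left, inner_smul_right, sub_eq_add_neg,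
      character_add, character_neg]
    simp only [Finset.mul_sum]
    rw [Finset.sum_comm]
    refine Finset.sum_congr rfl fun m _ => Finset.sum_congr rfl fun l _ => by ring
  apply Complex.ofReal_injective
  rw [← integral_complex_ofReal]
  simp_rw [key]
  rw [integral_finsetSum _ fun m _ => integrable_torus (by
    have := continuous_character; fun_prop)]
  push_cast
  rw [Finset.mul_sum]
  refine Finset.sum_congr rfl fun m hm => ?_
  rw [integral_finsetSum _ fun m _ => integrable_torus (by
    have := continuous_character; fun_prop)]
  simp_rw [integral_mul_const, integral_character, sub_eq_zero, ite_mul, zero_mul]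
  rw [Finset.sum_ite_eq' S m, if_pos hm, inner_self_eq_norm_sq_to_K]
  simp

theorem bessel_torus {u : (Fin 2 → ℝ) → V} (hu : Continuous u) (S : Finset (Fin 2 → ℤ))
    (a : (Fin 2 → ℤ) → V)
    (ha : ∀ n, ∫ θ, character (-n) θ • u θ ∂torusMeasure = ((2 * π : ℂ) ^ 2) • a n) :
    (2 * π) ^ 2 * ∑ n ∈ S, ‖a n‖ ^ 2 ≤ ∫ θ, ‖u θ‖ ^ 2 ∂torusMeasure := by
  have hc := continuous_character
  have hq : Continuous fun θ => ∑ m ∈ S, character m θ • a m := by fun_prop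
  have h1 : 0 ≤ ∫ θ, ‖u θ - ∑ m ∈ S, character m θ • a m‖ ^ 2 ∂torusMeasure :=
    integral_nonneg fun θ => by positivity
  have h2 : ∀ θ, ‖u θ - ∑ m ∈ S, character m θ • a m‖ ^ 2
      = ‖u θ‖ ^ 2 - 2 * RCLike.re (∑ m ∈ S, inner ℂ (a m) (character (-m) θ • u θ))
        + ‖∑ m ∈ S, character m θ • a m‖ ^ 2 := fun θ => by
    rw [@norm_sub_sq ℂ, ← inner_re_symm]
    simp only [sum_inner, inner_smul_left, inner_smul_right, character_neg]
  have hcont : ∀ m, Continuous fun θ => character (-m) θ • u θ := fun m => by fun_prop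
  have h3 : ∫ θ, RCLike.re (∑ m ∈ S, inner ℂ (a m) (character (-m) θ • u θ)) ∂torusMeasure
      = (2 * π) ^ 2 * ∑ m ∈ S, ‖a m‖ ^ 2 := by
    rw [integral_re (integrable_torus (by fun_prop)), integral_finsetSum _ fun m _ =>
      integrable_torus (by fun_prop)]
    have : ∀ m, ∫ θ, inner ℂ (a m) (character (-m) θ • u θ) ∂torusMeasure
        = (((2 * π) ^ 2 * ‖a m‖ ^ 2 : ℝ) : ℂ) := fun m => by
      rw [integral_inner (integrable_torus (hcont m)), ha, inner_smul_right,
        inner_self_eq_norm_sq_to_K]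
      simp
    simp_rw [this]
    rw [← ofReal_sum, ← Finset.mul_sum]
    exact ofReal_re _
  simp_rw [h2] at h1
  rw [integral_add (integrable_torus (by fun_prop)) (integrable_torus (by fun_prop)),
    integral_sub (integrable_torus (by fun_prop)) (integrable_torus (by fun_prop)),
    integral_const_mul, h3, integral_norm_sq_trigPoly] at h1
  linarith

end Fourier

section Schur

variable {E F : Type*} [NormedAddCommGroup E] [InnerProductSpace ℂ E] [CompleteSpace E]
  [NormedAddCommGroup F] [InnerProductSpace ℂ F] [CompleteSpace F]

variable (E F) in
/-- The Schur class `𝒮₂(E, E_*)` of holomorphic functions on the bidisk whose values are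
contractions `E → E_*`; here `F` is `E_*`. The values of `toFun` off the bidisk play no role. -/
structure SchurClass where
  toFun : (Fin 2 → ℂ) → E →L[ℂ] F
  differentiableOn : DifferentiableOn ℂ toFun bidisk
  norm_le_one : ∀ z ∈ bidisk, ‖toFun z‖ ≤ 1

/-- The Taylor coefficients of `Φ` at the origin, by Cauchy's integral formula over the torus
`|z_1| = |z_2| = 1/2`. The index ranges over `ℤ²`, and the coefficient is `0` as soon as an entry
of the index is negative. -/
def SchurClass.coeff (Φ : SchurClass E F) (n : Fin 2 → ℤ) : E →L[ℂ] F :=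
  ((2 * π * I : ℂ) ^ 2)⁻¹ •
    torusIntegral (fun z => (∏ i, z i ^ (-(n i + 1))) • Φ.toFun z) 0 (fun _ => 1 / 2)

namespace SchurClass
variable (Φ : SchurClass E F)

theorem coeff_integrand_differentiableOn (n : Fin 2 → ℤ) :
    DifferentiableOn ℂ (fun z : Fin 2 → ℂ => (∏ i, z i ^ (-(n i + 1))) • Φ.toFun z)
      (bidisk ∩ {z | ∀ i, z i ≠ 0}) := by
  suffices h : DifferentiableOn ℂ (fun z : Fin 2 → ℂ => ∏ i, z i ^ (-(n i + 1)))
      (bidisk ∩ {z | ∀ i, z i ≠ 0}) from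
    h.smul (Φ.differentiableOn.mono inter_subset_left)
  simp only [Fin.prod_univ_two]
  refine DifferentiableOn.mul ?_ ?_
  · exact DifferentiableOn.zpow (by fun_prop) (Or.inl fun z hz => hz.2 0)
  · exact DifferentiableOn.zpow (by fun_prop) (Or.inl fun z hz => hz.2 1)

theorem torusMap_mem {R : Fin 2 → ℝ} (hR : ∀ i, 0 < R i ∧ R i < 1) (θ : Fin 2 → ℝ) :
    torusMap 0 R θ ∈ (bidisk ∩ {z | ∀ i, z i ≠ 0}) := by
  constructor
  · intro i
    simpa [torusMap, norm_exp_ofReal_mul_I, abs_of_pos (hR i).1] using (hR i).2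
  · intro i
    simp [torusMap, (hR i).1.ne', exp_ne_zero]

theorem torusIntegrable_coeff (n : Fin 2 → ℤ) {R : Fin 2 → ℝ} (hR : ∀ i, 0 < R i ∧ R i < 1) :
    TorusIntegrable (fun z => (∏ i, z i ^ (-(n i + 1))) • Φ.toFun z) 0 R := by
  refine integrable_torus (ContinuousOn.comp_continuous
    (Φ.coeff_integrand_differentiableOn n).continuousOn ?_ fun θ => torusMap_mem hR θ)
  unfold torusMap; fun_prop

theorem circleIntegral_radius {f : ℂ → E →L[ℂ] F} {r s : ℝ} (hr : 0 < r) (hrs : r ≤ s) (hs : s < 1)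
    (hf : DifferentiableOn ℂ f {z | ‖z‖ < 1 ∧ z ≠ 0}) :
    circleIntegral f 0 s = circleIntegral f 0 r := by
  have hsub : Metric.closedBall (0 : ℂ) s \ Metric.ball 0 r ⊆ {z | ‖z‖ < 1 ∧ z ≠ 0} := by
    rintro z ⟨h1, h2⟩
    simp only [Metric.mem_closedBall, dist_zero_right, Metric.mem_ball, not_lt] at h1 h2
    exact ⟨h1.trans_lt hs, fun h => by simp [h] at h2; linarith⟩
  have hopen : IsOpen {z : ℂ | ‖z‖ < 1 ∧ z ≠ 0} :=
    (isOpen_lt continuous_norm continuous_const).inter isOpen_ne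
  refine circleIntegral_eq_of_differentiable_on_annulus_off_countable hr hrs countable_empty
    (hf.continuousOn.mono hsub) fun z hz => ?_
  refine (hf z ?_).differentiableAt (hopen.mem_nhds ?_)
  all_goals
    exact hsub ⟨Metric.ball_subset_closedBall hz.1.1, fun h => hz.1.2 (Metric.ball_subset_closedBall h)⟩

theorem torusIntegral_radius (n : Fin 2 → ℤ) {r : ℝ} (hr : 1 / 2 ≤ r) (hr1 : r < 1) :
    torusIntegral (fun z => (∏ i, z i ^ (-(n i + 1))) • Φ.toFun z) 0 (fun _ => r) =
    torusIntegral (fun z => (∏ i, z i ^ (-(n i + 1))) • Φ.toFun z) 0 (fun _ => 1 / 2) := by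
  set f : (Fin 2 → ℂ) → E →L[ℂ] F := fun z => (∏ i, z i ^ (-(n i + 1))) • Φ.toFun z with hf
  have hr0 : 0 < r := by linarith
  have step : ∀ (i : Fin 2) (R R' : Fin 2 → ℝ), (∀ j, 0 < R j ∧ R j < 1) →
      (∀ j, 0 < R' j ∧ R' j < 1) → R i = R' i → (∀ j, R' j ≤ R j) →
      torusIntegral f 0 R = torusIntegral f 0 R' := by
    intro i R R' hR hR' hi hle
    rw [torusIntegral_succAbove (Φ.torusIntegrable_coeff n hR) i,
      torusIntegral_succAbove (Φ.torusIntegrable_coeff n hR') i, ← hi]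
    refine circleIntegral.integral_congr (hR i).1.le fun x hx => ?_
    simp only [torusIntegral_dim1]
    refine circleIntegral_radius (hR' _).1 (hle _) (hR _).2 ?_
    have hx : ‖x‖ = R i := by simpa using hx
    refine (Φ.coeff_integrand_differentiableOn n).comp (f := fun z : ℂ =>
      i.insertNth (α := fun _ => ℂ) x fun _ => z) ?_ ?_
    · refine differentiableOn_pi.2 fun j => ?_
      induction j using i.succAboveCases with
      | x => simp
      | p j => simp only [Fin.insertNth_apply_succAbove]; fun_prop
    · intro z hz
      have hx0 : x ≠ 0 := by rw [← norm_pos_iff, hx]; exact (hR i).1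
      refine ⟨fun j => ?_, fun j => ?_⟩
      · induction j using i.succAboveCases with
        | x => simpa [hx] using (hR i).2
        | p j => simpa using hz.1
      · induction j using i.succAboveCases with
        | x => simpa using hx0
        | p j => simpa using hz.2
  rw [step 0 (fun _ => r) ![r, 1 / 2], step 1 ![r, 1 / 2] (fun _ => 1 / 2)]
  all_goals simp [Fin.forall_fin_two] <;> norm_num <;> grind

theorem integral_character_radius (n : Fin 2 → ℤ) {r : ℝ} (hr : 1 / 2 ≤ r) (hr1 : r < 1) :
    ∫ θ, character (-n) θ • Φ.toFun (torusMap 0 (fun _ => r) θ) ∂torusMeasure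
      = ((2 * π : ℂ) ^ 2) • ((r : ℂ) ^ (n 0 + n 1)) • Φ.coeff n := by
  have hr0 : (r : ℂ) ≠ 0 := by exact_mod_cast (by linarith : r ≠ 0)
  have h := Φ.torusIntegral_radius n hr hr1
  have h2 : torusIntegral (fun z => (∏ i, z i ^ (-(n i + 1))) • Φ.toFun z) 0 (fun _ => r)
      = (-((r : ℂ) ^ (n 0 + n 1))⁻¹) •
        ∫ θ, character (-n) θ • Φ.toFun (torusMap 0 (fun _ => r) θ) ∂torusMeasure := by
    rw [← integral_smul]
    refine integral_congr_ae (Filter.Eventually.of_forall fun θ => ?_)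
    simp only [smul_smul]
    congr 1
    have e0 := exp_ne_zero (θ 0 * I)
    have e1 := exp_ne_zero (θ 1 * I)
    simp only [Fin.prod_univ_two, torusMap, character, Pi.neg_apply, Pi.zero_apply, zero_add,
      mul_zpow, neg_add, zpow_add₀ hr0, zpow_add₀ e0, zpow_add₀ e1, zpow_neg, zpow_one]
    field_simp
    simp
  rw [coeff, ← h, h2]
  simp only [smul_smul]
  have hpi : (π : ℂ) ≠ 0 := by exact_mod_cast Real.pi_ne_zero
  have : (2 * (π : ℂ)) ^ 2 * ((r : ℂ) ^ (n 0 + n 1) * (((2 * π * I) ^ 2)⁻¹ * -((r : ℂ) ^ (n 0 + n 1))⁻¹)) = 1 := by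
    have := zpow_ne_zero (n 0 + n 1) hr0
    field_simp
    simp
  rw [this, one_smul]

theorem laurent_bound_radius (c : (Fin 2 → ℤ) → E) (T S : Finset (Fin 2 → ℤ))
    {r : ℝ} (hr : 1 / 2 ≤ r) (hr1 : r < 1) :
    ∑ n ∈ S, ‖∑ m ∈ T, ((r : ℂ) ^ ((n - m) 0 + (n - m) 1)) • Φ.coeff (n - m) (c m)‖ ^ 2
      ≤ ∑ m ∈ T, ‖c m‖ ^ 2 := by
  have hc := continuous_character
  have hmem : ∀ θ, torusMap 0 (fun _ => r) θ ∈ bidisk := fun θ =>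
    (torusMap_mem (fun _ => ⟨by linarith, hr1⟩) θ).1
  have hΦ : Continuous fun θ => Φ.toFun (torusMap 0 (fun _ => r) θ) :=
    Φ.differentiableOn.continuousOn.comp_continuous (by unfold torusMap; fun_prop) hmem
  set p : (Fin 2 → ℝ) → E := fun θ => ∑ m ∈ T, character m θ • c m with hp
  have hpc : Continuous p := by fun_prop
  have huc : Continuous fun θ => Φ.toFun (torusMap 0 (fun _ => r) θ) (p θ) := hΦ.clm_apply hpc
  have hb := bessel_torus huc S
    (fun n => ∑ m ∈ T, ((r : ℂ) ^ ((n - m) 0 + (n - m) 1)) • Φ.coeff (n - m) (c m)) fun n => by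
      have : ∀ θ, character (-n) θ • Φ.toFun (torusMap 0 (fun _ => r) θ) (p θ)
          = ∑ m ∈ T, (character (-(n - m)) θ • Φ.toFun (torusMap 0 (fun _ => r) θ)) (c m) := by
        intro θ
        rw [hp, map_sum, Finset.smul_sum]
        refine Finset.sum_congr rfl fun m _ => ?_
        rw [map_smul, smul_smul, ← character_add, smul_apply]
        congr 2; abel
      simp_rw [this]
      have hi : ∀ m, Continuous fun θ =>
          character (-(n - m)) θ • Φ.toFun (torusMap 0 (fun _ => r) θ) := fun m => by fun_prop
      rw [integral_finsetSum _ fun m _ => integrable_torus ((hi m).clm_apply continuous_const),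
        Finset.smul_sum]
      refine Finset.sum_congr rfl fun m _ => ?_
      rw [← ContinuousLinearMap.integral_apply (integrable_torus (hi m)),
        integral_character_radius Φ _ hr hr1]
      rfl
  have hle : ∫ θ, ‖Φ.toFun (torusMap 0 (fun _ => r) θ) (p θ)‖ ^ 2 ∂torusMeasure
      ≤ ∫ θ, ‖p θ‖ ^ 2 ∂torusMeasure := by
    refine integral_mono (integrable_torus (by fun_prop)) (integrable_torus (by fun_prop))
      fun θ => ?_
    have := (Φ.toFun (torusMap 0 (fun _ => r) θ)).le_of_opNorm_le (Φ.norm_le_one _ (hmem θ)) (p θ)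
    rw [one_mul] at this
    exact pow_le_pow_left₀ (norm_nonneg _) this 2
  rw [integral_norm_sq_trigPoly] at hle
  exact le_of_mul_le_mul_left (hb.trans hle) (by positivity)

theorem laurent_bound (c : (Fin 2 → ℤ) → E) (T S : Finset (Fin 2 → ℤ)) :
    ∑ n ∈ S, ‖∑ m ∈ T, Φ.coeff (n - m) (c m)‖ ^ 2 ≤ ∑ m ∈ T, ‖c m‖ ^ 2 := by
  have ht : Filter.Tendsto (fun r : ℝ =>
      ∑ n ∈ S, ‖∑ m ∈ T, ((r : ℂ) ^ ((n - m) 0 + (n - m) 1)) • Φ.coeff (n - m) (c m)‖ ^ 2)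
      (nhdsWithin 1 (Iio 1)) (nhds (∑ n ∈ S, ‖∑ m ∈ T, Φ.coeff (n - m) (c m)‖ ^ 2)) := by
    refine tendsto_nhdsWithin_of_tendsto_nhds ?_
    have : ContinuousAt (fun r : ℝ =>
      ∑ n ∈ S, ‖∑ m ∈ T, ((r : ℂ) ^ ((n - m) 0 + (n - m) 1)) • Φ.coeff (n - m) (c m)‖ ^ 2) 1 := by
      refine tendsto_finsetSum _ fun n _ => ContinuousAt.pow (ContinuousAt.norm
        (tendsto_finsetSum _ fun m _ => ContinuousAt.smul
          (ContinuousAt.zpow₀ (by fun_prop) _ (Or.inl (by simp))) continuousAt_const)) 2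
    simpa [ContinuousAt] using this
  refine le_of_tendsto ht ?_
  filter_upwards [Ioo_mem_nhdsLT (show (1 / 2 : ℝ) < 1 by norm_num)] with r hr
  exact Φ.laurent_bound_radius c T S hr.1.le hr.2

end SchurClass
end Schur

section Spaces

/-- `L²(𝕋²) ⊗ E`, the `E`-valued functions on the two-torus with square summable Fourier
coefficients; an element is represented by its family of Fourier coefficients, indexed by `ℤ²`. -/
abbrev L2 (E : Type*) [NormedAddCommGroup E] : Type _ := lp (fun _ : Fin 2 → ℤ => E) 2

variable {E F : Type*} [NormedAddCommGroup E] [InnerProductSpace ℂ E] [CompleteSpace E]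
  [NormedAddCommGroup F] [InnerProductSpace ℂ F] [CompleteSpace F]

theorem L2.norm_sq_eq (f : L2 E) : ‖f‖ ^ 2 = ∑' n, ‖f n‖ ^ 2 := by
  simpa using lp.norm_rpow_eq_tsum (p := 2) (by simp) f

/-- Trigonometric polynomials with coefficients in `E`, as elements of `L²(E)`. -/
def finL2 : ((Fin 2 → ℤ) →₀ E) →ₗ[ℂ] L2 E :=
  Finsupp.lsum ℂ fun m => (lp.singleContinuousLinearMap ℂ (fun _ : Fin 2 → ℤ => E) 2 m).toLinearMap

theorem finL2_apply (c : (Fin 2 → ℤ) →₀ E) : finL2 c = ∑ m ∈ c.support, lp.single 2 m (c m) := by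
  simp [finL2, Finsupp.sum]

theorem norm_finL2_sq (c : (Fin 2 → ℤ) →₀ E) : ‖finL2 c‖ ^ 2 = ∑ m ∈ c.support, ‖c m‖ ^ 2 := by
  rw [finL2_apply]
  simpa using lp.norm_sum_single (E := fun _ : Fin 2 → ℤ => E) (p := 2) (by simp) c c.support

theorem denseRange_finL2 : DenseRange (finL2 : ((Fin 2 → ℤ) →₀ E) →ₗ[ℂ] L2 E) := by
  intro f
  have h := lp.hasSum_single (E := fun _ : Fin 2 → ℤ => E) (p := 2) (by simp) f
  refine mem_closure_of_tendsto h (Filter.Eventually.of_forall fun s => ?_)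
  refine ⟨∑ m ∈ s, Finsupp.single m (f m), ?_⟩
  simp [finL2]

/-- Multiplication by `Φ` on trigonometric polynomials: convolution with the Taylor
coefficients of `Φ`. -/
def SchurClass.preMul (Φ : SchurClass E F) : ((Fin 2 → ℤ) →₀ E) →ₗ[ℂ] L2 F where
  toFun c := ⟨fun n => ∑ m ∈ c.support, Φ.coeff (n - m) (c m),
    memℓp_gen' (C := ∑ m ∈ c.support, ‖c m‖ ^ 2) fun S => by
      simpa using Φ.laurent_bound c c.support S⟩
  map_add' c d := by
    ext n
    exact Finsupp.sum_add_index' (h := fun m x => Φ.coeff (n - m) x) (by simp) (by simp)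
  map_smul' a c := by
    ext n
    change (a • c).sum (fun m x => Φ.coeff (n - m) x) = a • c.sum (fun m x => Φ.coeff (n - m) x)
    rw [Finsupp.sum_smul_index' (by simp), Finsupp.smul_sum]
    simp

theorem SchurClass.preMul_apply (Φ : SchurClass E F) (c : (Fin 2 → ℤ) →₀ E) (n : Fin 2 → ℤ) :
    Φ.preMul c n = ∑ m ∈ c.support, Φ.coeff (n - m) (c m) := rfl

theorem SchurClass.norm_preMul_le (Φ : SchurClass E F) (c : (Fin 2 → ℤ) →₀ E) :
    ‖Φ.preMul c‖ ≤ 1 * ‖finL2 c‖ := by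
  rw [one_mul]
  refine lp.norm_le_of_forall_sum_le (by simp) (norm_nonneg _) fun S => ?_
  have := Φ.laurent_bound c c.support S
  rw [← norm_finL2_sq] at this
  simpa [SchurClass.preMul_apply] using this

/-- Multiplication by (the boundary values of) `Φ`, a contraction `L²(E) → L²(E_*)`: the
continuous extension of the convolution with the Taylor coefficients from the dense subspace of
trigonometric polynomials. Its adjoint is multiplication by `Φ*`. -/
def SchurClass.mulOp (Φ : SchurClass E F) : L2 E →L[ℂ] L2 F := Φ.preMul.extendOfNorm finL2

theorem SchurClass.norm_mulOp_le (Φ : SchurClass E F) : ‖Φ.mulOp‖ ≤ 1 :=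
  ContinuousLinearMap.opNorm_le_bound _ zero_le_one fun f =>
    LinearMap.norm_extendOfNorm_apply_le (f := Φ.preMul) (e := finL2) denseRange_finL2 1
      Φ.norm_preMul_le f

theorem SchurClass.mulOp_single (Φ : SchurClass E F) (m n : Fin 2 → ℤ) (x : E) :
    Φ.mulOp (lp.single 2 m x) n = Φ.coeff (n - m) x := by
  have h := LinearMap.extendOfNorm_eq (f := Φ.preMul) denseRange_finL2 ⟨1, Φ.norm_preMul_le⟩
    (Finsupp.single m x)
  have h1 : finL2 (Finsupp.single m x) = lp.single 2 m x := by simp [finL2]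
  rw [h1] at h
  rw [mulOp, h, preMul_apply]
  exact Finsupp.sum_single_index (h := fun m x => Φ.coeff (n - m) x) (by simp)


theorem memℓp_shift (j : Fin 2) (f : L2 E) :
    Memℓp (fun n : Fin 2 → ℤ => f (n - Pi.single j 1)) 2 := by
  have h : Summable fun n => ‖f n‖ ^ (2 : ENNReal).toReal := (lp.memℓp f).summable (by simp)
  refine memℓp_gen ?_
  exact h.comp_injective (i := fun n : Fin 2 → ℤ => n - Pi.single j 1) sub_left_injective

/-- Multiplication by the coordinate function `Z_j` on `L²(E)`. -/
def shift (j : Fin 2) : L2 E →ₗᵢ[ℂ] L2 E where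
  toFun f := ⟨fun n => f (n - Pi.single j 1), memℓp_shift j f⟩
  map_add' _ _ := rfl
  map_smul' _ _ := rfl
  norm_map' f := by
    refine (sq_eq_sq₀ (norm_nonneg _) (norm_nonneg _)).1 ?_
    rw [L2.norm_sq_eq, L2.norm_sq_eq]
    exact (Equiv.subRight (Pi.single j (1 : ℤ))).tsum_eq fun n => ‖f n‖ ^ 2

theorem shift_apply (j : Fin 2) (f : L2 E) (n : Fin 2 → ℤ) :
    shift j f n = f (n - Pi.single j 1) := rfl

theorem shift_single (j : Fin 2) (m : Fin 2 → ℤ) (x : E) :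
    shift j (lp.single 2 m x : L2 E) = lp.single 2 (m + Pi.single j 1) x := by
  ext n
  rw [shift_apply, lp.single_apply, lp.single_apply, Pi.single_apply, Pi.single_apply]
  simp only [sub_eq_iff_eq_add]

theorem shift_surjective (j : Fin 2) : Function.Surjective (shift j : L2 E → L2 E) := by
  intro f
  have h : Summable fun n => ‖f n‖ ^ (2 : ENNReal).toReal := (lp.memℓp f).summable (by simp)
  have h2 : Memℓp (fun n : Fin 2 → ℤ => f (n + Pi.single j 1)) 2 := by
    refine memℓp_gen ?_
    exact h.comp_injective (i := fun n : Fin 2 → ℤ => n + Pi.single j 1) (add_left_injective _)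
  refine ⟨⟨_, h2⟩, ?_⟩
  ext n
  rw [shift_apply]
  exact congrArg f (sub_add_cancel n _)

/-- The functions in `L²(E)` whose Fourier coefficients vanish off `N`. -/
def suppIn (N : Set (Fin 2 → ℤ)) : Submodule ℂ (L2 E) where
  carrier := {f | ∀ n ∉ N, f n = 0}
  add_mem' {f g} hf hg n hn := by simp [hf n hn, hg n hn]
  zero_mem' n _ := rfl
  smul_mem' c f hf n hn := by simp [hf n hn]

variable (E) in
/-- The Hardy space `H²(E)` of the bidisk, as a subspace of `L²(E)`. -/
def H2 : Submodule ℂ (L2 E) := suppIn {n | ∀ i, 0 ≤ n i}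

variable (E) in
/-- For `j = 0` this is `L²_{+-}(E)`, for `j = 1` it is `L²_{-+}(E)`. -/
def L2plusMinus (j : Fin 2) : Submodule ℂ (L2 E) := suppIn {n | 0 ≤ n j ∧ ∀ i ≠ j, n i < 0}

variable (E) in
/-- Point evaluation `f ↦ f(w) = ∑_{n ≥ 0} f̂(n) wⁿ` at a point of the bidisk; it is only used on
elements of `H²(E)`. -/
def evalAt (w : bidisk) : L2 E →L[ℂ] E :=
  ∑' n : Fin 2 → ℕ, (∏ i, w.1 i ^ n i) •
    lp.evalCLM ℂ (fun _ : Fin 2 → ℤ => E) 2 (fun i => (n i : ℤ))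

theorem summable_pow_smul {A : Type*} [NormedAddCommGroup A] [NormedSpace ℂ A] [CompleteSpace A]
    (w : bidisk) (T : (Fin 2 → ℕ) → A) (hT : ∀ n, ‖T n‖ ≤ 1) :
    Summable fun n : Fin 2 → ℕ => (∏ i, w.1 i ^ n i) • T n := by
  have hg : Summable fun p : ℕ × ℕ => ‖w.1 0‖ ^ p.1 * ‖w.1 1‖ ^ p.2 :=
    (summable_geometric_of_lt_one (norm_nonneg _) (w.2 0)).mul_of_nonneg
      (summable_geometric_of_lt_one (norm_nonneg _) (w.2 1))
      (fun _ => by positivity) (fun _ => by positivity)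
  have hinj : Function.Injective fun n : Fin 2 → ℕ => (n 0, n 1) := fun n m h => by
    have h' := Prod.mk.inj h
    funext i
    fin_cases i
    exacts [h'.1, h'.2]
  have hg' := hg.comp_injective hinj
  simp only [Function.comp_def] at hg'
  refine Summable.of_norm_bounded hg' fun n => ?_
  rw [norm_smul, Fin.prod_univ_two, norm_mul, norm_pow, norm_pow]
  exact mul_le_of_le_one_right (by positivity) (hT n)

theorem hasSum_evalAt (w : bidisk) (f : L2 E) :
    HasSum (fun n : Fin 2 → ℕ => (∏ i, w.1 i ^ n i) • f fun i => (n i : ℤ)) (evalAt E w f) := by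
  have h := summable_pow_smul w
    (fun n => lp.evalCLM ℂ (fun _ : Fin 2 → ℤ => E) 2 (fun i => (n i : ℤ)))
    fun n => LinearMap.mkContinuous_norm_le _ zero_le_one _
  have h' := h.hasSum.mapL (ContinuousLinearMap.apply ℂ E f)
  rw [evalAt]
  exact h'

end Spaces

section OpRange

variable {X : Type*} [NormedAddCommGroup X] [InnerProductSpace ℂ X] [CompleteSpace X]
  {Y : Type*} [AddCommGroup Y] [Module ℂ Y] [TopologicalSpace Y] [T1Space Y]

/-- The operator range of a bounded operator `R` defined on a Hilbert space: the image of `R`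
with the inner product `⟪R x, R y⟫ = ⟪P x, y⟫`, where `P` is the orthogonal projection onto
`(ker R)ᗮ` (see `OpRange.inner_mk_mk`). The target may be a Hilbert space or a space of functions. -/
def OpRange (R : X →L[ℂ] Y) : Type _ := LinearMap.range R.toLinearMap

namespace OpRange

variable (R : X →L[ℂ] Y)

section Construction

@[reducible] def addCommGroupAux : AddCommGroup (OpRange R) :=
  inferInstanceAs (AddCommGroup (LinearMap.range R.toLinearMap))

attribute [local instance] addCommGroupAux

@[reducible] def moduleAux : Module ℂ (OpRange R) :=
  inferInstanceAs (Module ℂ (LinearMap.range R.toLinearMap))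

attribute [local instance] moduleAux

instance : CompleteSpace (LinearMap.ker R.toLinearMap) := R.isClosed_ker.completeSpace_coe

/-- `R` restricts to a bijection of `(ker R)ᗮ` onto its range; this is the inverse. -/
def equivKerOrthogonal : OpRange R ≃ₗ[ℂ] (LinearMap.ker R.toLinearMap)ᗮ :=
  R.toLinearMap.quotKerEquivRange.symm ≪≫ₗ
    Submodule.quotientEquivOfIsCompl _ _ (Submodule.isCompl_orthogonal _)

instance : NormedAddCommGroup (OpRange R) :=
  NormedAddCommGroup.induced (OpRange R) _ (equivKerOrthogonal R) (equivKerOrthogonal R).injective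

instance : InnerProductSpace ℂ (OpRange R) where
  inner u v := inner ℂ (equivKerOrthogonal R u) (equivKerOrthogonal R v)
  norm_smul_le a u := by
    change ‖equivKerOrthogonal R (a • u)‖ ≤ ‖a‖ * ‖equivKerOrthogonal R u‖
    rw [map_smul, norm_smul]
  norm_sq_eq_re_inner u := norm_sq_eq_re_inner (𝕜 := ℂ) (equivKerOrthogonal R u)
  conj_inner_symm u v := inner_conj_symm _ _
  add_left u v w := by rw [map_add, inner_add_left]
  smul_left u v a := by rw [map_smul, inner_smul_left]

end Construction

/-- The operator range is isometric to `(ker R)ᗮ`. -/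
def isometryEquiv : OpRange R ≃ₗᵢ[ℂ] (LinearMap.ker R.toLinearMap)ᗮ where
  __ := equivKerOrthogonal R
  norm_map' _ := rfl

instance : CompleteSpace (OpRange R) :=
  (isometryEquiv R).toIsometryEquiv.completeSpace


/-- The preimage of least norm of an element of the operator range. -/
def lift : OpRange R →L[ℂ] X :=
  (LinearMap.ker R.toLinearMap)ᗮ.subtypeL ∘L (isometryEquiv R).toContinuousLinearEquiv

/-- The map `x ↦ R x` into the operator range. -/
def mk : X →L[ℂ] OpRange R :=
  (isometryEquiv R).symm.toContinuousLinearEquiv ∘L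
    (LinearMap.ker R.toLinearMap)ᗮ.orthogonalProjectionOnto

theorem coe_mk (x : X) : Subtype.val (p := (· ∈ LinearMap.range R.toLinearMap)) (mk R x) = R x := by
  set y : LinearMap.range R.toLinearMap := ⟨R x, x, rfl⟩ with hy
  have h : isometryEquiv R y = (LinearMap.ker R.toLinearMap)ᗮ.orthogonalProjectionOnto x := by
    have h0 : R.toLinearMap.quotKerEquivRange.symm y = Submodule.Quotient.mk x :=
      (LinearEquiv.symm_apply_eq _).2 rfl
    change Submodule.quotientEquivOfIsCompl _ _ (Submodule.isCompl_orthogonal _) (R.toLinearMap.quotKerEquivRange.symm y) = _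
    rw [h0, Submodule.quotientEquivOfIsCompl_apply_mk,
      Submodule.orthogonalProjectionOnto_apply_eq_projectionOnto]
    simp
  have h2 : mk R x = y := ((isometryEquiv R).symm_apply_eq.2 h.symm)
  exact congrArg (Subtype.val (p := (· ∈ LinearMap.range R.toLinearMap))) h2

theorem coe_eq (u : OpRange R) : Subtype.val (p := (· ∈ LinearMap.range R.toLinearMap)) u = R (lift R u) := by
  have h := coe_mk R (lift R u)
  rw [← h]
  congr 1
  change u = (isometryEquiv R).symm (Submodule.orthogonalProjectionOnto _ _)
  rw [lift, ContinuousLinearMap.comp_apply, Submodule.subtypeL_apply,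
    Submodule.orthogonalProjectionOnto_mem_subspace_eq_self]
  exact ((isometryEquiv R).symm_apply_apply u).symm

/-- The inclusion of the operator range into the target of `R`. -/
def incl : OpRange R →L[ℂ] Y := R ∘L lift R

theorem incl_apply (u : OpRange R) : incl R u = Subtype.val (p := (· ∈ LinearMap.range R.toLinearMap)) u :=
  (coe_eq R u).symm

theorem incl_injective : Function.Injective (incl R) := fun u v h => by
  rw [incl_apply, incl_apply] at h
  exact Subtype.ext h

theorem incl_mk (x : X) : incl R (mk R x) = R x := by rw [incl_apply, coe_mk]

theorem inner_mk_mk (x y : X) : inner ℂ (mk R x) (mk R y)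
    = inner ℂ ((LinearMap.ker R.toLinearMap)ᗮ.starProjection x) y := by
  change inner ℂ (isometryEquiv R (mk R x)) (isometryEquiv R (mk R y)) = _
  have h : ∀ z, isometryEquiv R (mk R z)
      = (LinearMap.ker R.toLinearMap)ᗮ.orthogonalProjectionOnto z := fun z =>
    (isometryEquiv R).apply_symm_apply _
  rw [h, h, Submodule.coe_inner, ← Submodule.starProjection_apply, ← Submodule.starProjection_apply]
  rw [Submodule.inner_starProjection_left_eq_right, Submodule.inner_starProjection_left_eq_right]
  congr 1
  exact Submodule.starProjection_eq_self_iff.2 (Submodule.starProjection_apply_mem _ _)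

end OpRange

/-- The operator range of a map into functions with bounded point evaluations is a reproducing
kernel Hilbert space. -/
instance {Ω F : Type*} [NormedAddCommGroup F] [InnerProductSpace ℂ F] (R : X →L[ℂ] (Ω → F)) :
    RKHS ℂ (OpRange R) Ω F where
  coeCLM := OpRange.incl R
  coeCLM_injective := OpRange.incl_injective R

end OpRange

section Sqrt

variable {H : Type*} [NormedAddCommGroup H] [InnerProductSpace ℂ H] [CompleteSpace H]

/-- The positive square root of a positive operator. -/
def sqrtOp (T : H →L[ℂ] H) : H →L[ℂ] H := CFC.sqrt T

theorem sqrtOp_sqrtOp {T : H →L[ℂ] H} (hT : 0 ≤ T) (x : H) : sqrtOp T (sqrtOp T x) = T x :=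
  congrArg (fun A : H →L[ℂ] H => A x) (CFC.sqrt_mul_sqrt_self T hT)

theorem sqrtOp_comm {T D : H →L[ℂ] H} (h : ∀ x, T (D x) = D (T x)) (x : H) :
    sqrtOp T (D x) = D (sqrtOp T x) := by
  have : Commute T D := ContinuousLinearMap.ext h
  exact congrArg (fun A : H →L[ℂ] H => A x) (this.cfcₙ_nnreal NNReal.sqrt).eq

end Sqrt

section Model

variable {E F : Type*} [NormedAddCommGroup E] [InnerProductSpace ℂ E] [CompleteSpace E]
  [NormedAddCommGroup F] [InnerProductSpace ℂ F] [CompleteSpace F]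

variable (E F) in
/-- `L²(E_*) ⊕ L²(E)`, with `F` in the role of `E_*`. -/
abbrev PairL2 : Type _ := WithLp 2 (L2 F × L2 E)

namespace SchurClass
variable (Φ : SchurClass E F)

/-- The operator `[I Φ; Φ* I]` on `L²(E_*) ⊕ L²(E)`. -/
def blockOp : PairL2 E F →L[ℂ] PairL2 E F :=
  (WithLp.prodContinuousLinearEquiv 2 ℂ (L2 F) (L2 E)).symm.toContinuousLinearMap ∘L
    (WithLp.fstL 2 ℂ (L2 F) (L2 E) + Φ.mulOp ∘L WithLp.sndL 2 ℂ (L2 F) (L2 E)).prod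
      (Φ.mulOp.adjoint ∘L WithLp.fstL 2 ℂ (L2 F) (L2 E) + WithLp.sndL 2 ℂ (L2 F) (L2 E))

theorem blockOp_apply (u : PairL2 E F) :
    Φ.blockOp u = WithLp.toLp 2 (u.fst + Φ.mulOp u.snd, Φ.mulOp.adjoint u.fst + u.snd) := rfl

theorem blockOp_nonneg : 0 ≤ Φ.blockOp := by
  rw [ContinuousLinearMap.nonneg_iff_isPositive]
  refine (ContinuousLinearMap.isPositive_def' ).2 ⟨?_, fun u => ?_⟩
  · rw [ContinuousLinearMap.isSelfAdjoint_iff_isSymmetric]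
    intro u v
    simp [blockOp_apply, WithLp.prod_inner_apply, inner_add_left, inner_add_right,
      ContinuousLinearMap.adjoint_inner_left, ContinuousLinearMap.adjoint_inner_right]
    ring
  · have h1 : ‖Φ.mulOp u.snd‖ ≤ ‖u.snd‖ := by
      simpa using Φ.mulOp.le_of_opNorm_le Φ.norm_mulOp_le u.snd
    have h2 : RCLike.re (inner ℂ (Φ.mulOp u.snd) u.fst) = RCLike.re (inner ℂ u.fst (Φ.mulOp u.snd)) :=
      inner_re_symm _ _
    have h3 : -RCLike.re (inner ℂ (Φ.mulOp u.snd) u.fst) ≤ ‖u.snd‖ * ‖u.fst‖ :=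
      (neg_le_abs _).trans ((abs_re_le_norm _).trans ((norm_inner_le_norm _ _).trans (by gcongr)))
    have h4 : RCLike.re (inner ℂ u.fst u.fst) = ‖u.fst‖ ^ 2 := inner_self_eq_norm_sq _
    have h5 : RCLike.re (inner ℂ u.snd u.snd) = ‖u.snd‖ ^ 2 := inner_self_eq_norm_sq _
    have : Φ.blockOp.reApplyInnerSelf u = ‖u.fst‖ ^ 2 + RCLike.re (inner ℂ (Φ.mulOp u.snd) u.fst)
        + (RCLike.re (inner ℂ u.fst (Φ.mulOp u.snd)) + ‖u.snd‖ ^ 2) := by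
      rw [← h4, ← h5]
      simp only [ContinuousLinearMap.reApplyInnerSelf, blockOp_apply, WithLp.prod_inner_apply,
        inner_add_left, ContinuousLinearMap.adjoint_inner_left, map_add]
      rfl
    rw [this, ← h2]
    nlinarith [sq_nonneg (‖u.fst‖ - ‖u.snd‖)]

/-- The operator `[I Φ; Φ* I]^{1/2}`. -/
def sqrtBlockOp : PairL2 E F →L[ℂ] PairL2 E F := sqrtOp Φ.blockOp

theorem sqrtBlockOp_sq (u : PairL2 E F) : Φ.sqrtBlockOp (Φ.sqrtBlockOp u) = Φ.blockOp u :=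
  sqrtOp_sqrtOp Φ.blockOp_nonneg u

/-- The space of the de Branges–Rovnyak model of `Φ`: the operator range of
`[I Φ; Φ* I]^{1/2}`. -/
abbrev ScatteringSpace : Type _ := OpRange Φ.sqrtBlockOp

/-- The inclusion of the model space into `L²(E_*) ⊕ L²(E)`. -/
def pair : Φ.ScatteringSpace →L[ℂ] PairL2 E F := OpRange.incl Φ.sqrtBlockOp

/-- `[f; g] ↦ [I Φ; Φ* I] [f; g]`, as an element of the model space. -/
def block : PairL2 E F →L[ℂ] Φ.ScatteringSpace := OpRange.mk Φ.sqrtBlockOp ∘L Φ.sqrtBlockOp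

theorem pair_block (u : PairL2 E F) : Φ.pair (Φ.block u) = Φ.blockOp u :=
  (OpRange.incl_mk _ _).trans (Φ.sqrtBlockOp_sq u)

/-- `g ↦ [Φ; I] g = [I Φ; Φ* I] [0; g]`, as an element of the model space. -/
def outCol : L2 E →ₗ[ℂ] Φ.ScatteringSpace where
  toFun g := Φ.block (WithLp.toLp 2 (0, g))
  map_add' g h := by
    rw [← map_add, ← WithLp.toLp_add, Prod.mk_add_mk, add_zero]
  map_smul' a g := by
    rw [RingHom.id_apply, ← map_smul, ← WithLp.toLp_smul, Prod.smul_mk, smul_zero]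

theorem pair_outCol (g : L2 E) : Φ.pair (Φ.outCol g) = WithLp.toLp 2 (Φ.mulOp g, g) := by
  simp [outCol, pair_block, blockOp_apply]

/-- `f ↦ [I; Φ*] f = [I Φ; Φ* I] [f; 0]`, as an element of the model space. -/
def inCol : L2 F →ₗ[ℂ] Φ.ScatteringSpace where
  toFun f := Φ.block (WithLp.toLp 2 (f, 0))
  map_add' g h := by
    rw [← map_add, ← WithLp.toLp_add, Prod.mk_add_mk, add_zero]
  map_smul' a g := by
    rw [RingHom.id_apply, ← map_smul, ← WithLp.toLp_smul, Prod.smul_mk, smul_zero]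

theorem pair_inCol (f : L2 F) :
    Φ.pair (Φ.inCol f) = WithLp.toLp 2 (f, Φ.mulOp.adjoint f) := by
  simp [inCol, pair_block, blockOp_apply]

variable (E F) in
/-- Multiplication by `Z_j` in both components of `L²(E_*) ⊕ L²(E)`. -/
def pairShift (j : Fin 2) : PairL2 E F →L[ℂ] PairL2 E F :=
  (WithLp.prodContinuousLinearEquiv 2 ℂ (L2 F) (L2 E)).symm.toContinuousLinearMap ∘L
    ((shift j).toContinuousLinearMap ∘L WithLp.fstL 2 ℂ (L2 F) (L2 E)).prod
      ((shift j).toContinuousLinearMap ∘L WithLp.sndL 2 ℂ (L2 F) (L2 E))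

/-- Multiplication by `Z_j` on the model space (see `pair_mulZ`). -/
def mulZ (j : Fin 2) : Φ.ScatteringSpace →L[ℂ] Φ.ScatteringSpace :=
  OpRange.mk Φ.sqrtBlockOp ∘L pairShift E F j ∘L OpRange.lift Φ.sqrtBlockOp

theorem mulOp_shift (j : Fin 2) (f : L2 E) : Φ.mulOp (shift j f) = shift j (Φ.mulOp f) := by
  have h : Φ.mulOp ∘L (shift j).toContinuousLinearMap = (shift j).toContinuousLinearMap ∘L Φ.mulOp := by
    refine lp.ext_continuousLinearMap (by simp) fun m => ContinuousLinearMap.ext fun x => ?_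
    ext n
    change Φ.mulOp (shift j (lp.single 2 m x)) n = Φ.mulOp (lp.single 2 m x) (n - Pi.single j 1)
    rw [shift_single, mulOp_single, mulOp_single, sub_sub, add_comm m]
  exact congrArg (fun A : L2 E →L[ℂ] L2 F => A f) h

theorem adjoint_mulOp_shift (j : Fin 2) (f : L2 F) :
    Φ.mulOp.adjoint (shift j f) = shift j (Φ.mulOp.adjoint f) := by
  refine ext_inner_left ℂ fun v => ?_
  obtain ⟨g, rfl⟩ := shift_surjective j v
  rw [ContinuousLinearMap.adjoint_inner_right, mulOp_shift, LinearIsometry.inner_map_map,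
    LinearIsometry.inner_map_map, ContinuousLinearMap.adjoint_inner_right]

theorem pair_mulZ (j : Fin 2) (u : Φ.ScatteringSpace) :
    Φ.pair (Φ.mulZ j u) = WithLp.toLp 2 (shift j (Φ.pair u).fst, shift j (Φ.pair u).snd) := by
  have hc : ∀ x : PairL2 E F, Φ.blockOp (pairShift E F j x) = pairShift E F j (Φ.blockOp x) := fun x => by
    change WithLp.toLp 2 (shift j x.fst + Φ.mulOp (shift j x.snd),
      Φ.mulOp.adjoint (shift j x.fst) + shift j x.snd) =
      WithLp.toLp 2 (shift j (x.fst + Φ.mulOp x.snd), shift j (Φ.mulOp.adjoint x.fst + x.snd))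
    rw [mulOp_shift, adjoint_mulOp_shift, map_add, map_add]
  change OpRange.incl _ (OpRange.mk _ (pairShift E F j (OpRange.lift _ u))) = _
  rw [OpRange.incl_mk]
  exact sqrtOp_comm hc _

/-- The outgoing subspace `[Φ; I] H²(E)`. -/
def outgoing : Submodule ℂ Φ.ScatteringSpace := (H2 E).map Φ.outCol

/-- The incoming subspace `[I; Φ*] (L² ⊖ H²)(E_*)`. -/
def incoming : Submodule ℂ Φ.ScatteringSpace := ((H2 F)ᗮ).map Φ.inCol

/-- The scattering subspace `𝒦_Φ`, the complement of the incoming and outgoing subspaces. -/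
def scatteringSubspace : Submodule ℂ Φ.ScatteringSpace := (Φ.incoming ⊔ Φ.outgoing)ᗮ

instance : CompleteSpace Φ.scatteringSubspace :=
  (Submodule.isClosed_orthogonal _).completeSpace_coe

/-- `S_j^max`: the elements `u` of `𝒦_Φ` with `Z_j^k u ∈ 𝒦_Φ` for all `k`. -/
def Smax (j : Fin 2) : Submodule ℂ Φ.ScatteringSpace :=
  ⨅ k : ℕ, Φ.scatteringSubspace.comap ((Φ.mulZ j ^ k : _ →L[ℂ] _) : _ →ₗ[ℂ] _)

/-- `S_j^min`: the closure of the projection to `𝒦_Φ` of `[Φ; I] L²_{+-}(E)` (`j = 0`) or of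
`[Φ; I] L²_{-+}(E)` (`j = 1`). -/
def Smin (j : Fin 2) : Submodule ℂ Φ.ScatteringSpace :=
  (((L2plusMinus E j).map Φ.outCol).map
    (Φ.scatteringSubspace.starProjection : _ →ₗ[ℂ] _)).topologicalClosure

/-- `S ⊖ Z_j S`. -/
def wandering (j : Fin 2) (S : Submodule ℂ Φ.ScatteringSpace) : Submodule ℂ Φ.ScatteringSpace :=
  S ⊓ (S.map (Φ.mulZ j : _ →ₗ[ℂ] _))ᗮ

/-- The residual subspace `ℛ = S_1^max ⊖ S_1^min`. -/
def residual : Submodule ℂ Φ.ScatteringSpace := Φ.Smax 0 ⊓ (Φ.Smin 0)ᗮ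

/-- `[f; g] ↦ f`, with `f` viewed as a function on the bidisk. On `𝒦_Φ`, where `f ∈ H²(E_*)`, this
is the adjoint `V*` of the canonical isometry `V` of the de Branges–Rovnyak space of `Φ` into
`𝒦_Φ`. -/
def firstComponent : Φ.ScatteringSpace →L[ℂ] (bidisk → F) :=
  ContinuousLinearMap.pi fun w => evalAt F w ∘L WithLp.fstL 2 ℂ (L2 F) (L2 E) ∘L Φ.pair

/-- The reproducing kernel of the operator range of `V*|_S`, for a closed subspace `S` of `𝒦_Φ`:
the Hilbert space of all `f` such that `[f; g] ∈ S` for some `g`, with the norm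
`‖f‖ = min {‖[f; g]‖ : [f; g] ∈ S}`. -/
def kernelOf (S : Submodule ℂ Φ.ScatteringSpace) [CompleteSpace S] :
    bidisk → bidisk → (F →L[ℂ] F) :=
  RKHS.kernel (OpRange (X := S) (Φ.firstComponent ∘L S.subtypeL))

theorem isClosed_scatteringSubspace :
    IsClosed (Φ.scatteringSubspace : Set Φ.ScatteringSpace) :=
  Submodule.isClosed_orthogonal _

theorem isClosed_Smax (j : Fin 2) : IsClosed (Φ.Smax j : Set Φ.ScatteringSpace) := by
  rw [Smax, Submodule.coe_iInf]
  exact isClosed_iInter fun k =>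
    Φ.isClosed_scatteringSubspace.preimage (Φ.mulZ j ^ k).continuous

theorem isClosed_Smin (j : Fin 2) : IsClosed (Φ.Smin j : Set Φ.ScatteringSpace) :=
  Submodule.isClosed_topologicalClosure _

theorem isClosed_wandering (j : Fin 2) {S : Submodule ℂ Φ.ScatteringSpace}
    (hS : IsClosed (S : Set Φ.ScatteringSpace)) :
    IsClosed (Φ.wandering j S : Set Φ.ScatteringSpace) :=
  hS.inter (Submodule.isClosed_orthogonal _)

instance (j : Fin 2) : CompleteSpace (Φ.wandering j (Φ.Smax j)) :=
  (Φ.isClosed_wandering j (Φ.isClosed_Smax j)).completeSpace_coe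

instance (j : Fin 2) : CompleteSpace (Φ.wandering j (Φ.Smin j)) :=
  (Φ.isClosed_wandering j (Φ.isClosed_Smin j)).completeSpace_coe

instance : CompleteSpace Φ.residual :=
  ((Φ.isClosed_Smax 0).inter (Submodule.isClosed_orthogonal _)).completeSpace_coe

/-- The extremal kernel `K_j^max` (the index `j = 0, 1` stands for the variable `z_1, z_2`). -/
def Kmax (j : Fin 2) : bidisk → bidisk → (F →L[ℂ] F) := Φ.kernelOf (Φ.wandering j (Φ.Smax j))

/-- The extremal kernel `K_j^min` (the index `j = 0, 1` stands for the variable `z_1, z_2`). -/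
def Kmin (j : Fin 2) : bidisk → bidisk → (F →L[ℂ] F) := Φ.kernelOf (Φ.wandering j (Φ.Smin j))

/-- The residual kernel `G`. -/
def residualKernel : bidisk → bidisk → (F →L[ℂ] F) := Φ.kernelOf Φ.residual

end SchurClass
end Model

section Kernels

/-- Positive operator valued kernels. -/
def IsPositiveKernel {Ω F : Type*} [NormedAddCommGroup F] [InnerProductSpace ℂ F]
    (K : Ω → Ω → (F →L[ℂ] F)) : Prop :=
  ∀ (N : ℕ) (x : Fin N → Ω) (η : Fin N → F),
    0 ≤ ∑ i, ∑ j, inner ℂ (η i) (K (x i) (x j) (η j))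

variable {E F : Type*} [NormedAddCommGroup E] [InnerProductSpace ℂ E] [CompleteSpace E]
  [NormedAddCommGroup F] [InnerProductSpace ℂ F] [CompleteSpace F]

/-- `(K₁, K₂)` are Agler kernels of `Φ`. Note the order: `K₂` goes with the first variable. -/
structure SchurClass.IsAglerPair (Φ : SchurClass E F) (K₁ K₂ : bidisk → bidisk → (F →L[ℂ] F)) :
    Prop where
  pos₁ : IsPositiveKernel K₁
  pos₂ : IsPositiveKernel K₂
  decomp : ∀ z w : bidisk,
    ContinuousLinearMap.id ℂ F - Φ.toFun z ∘L (Φ.toFun w).adjoint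
      = (1 - z.1 0 * (starRingEnd ℂ) (w.1 0)) • K₂ z w
        + (1 - z.1 1 * (starRingEnd ℂ) (w.1 1)) • K₁ z w

end Kernels

end BidiskAgler
end

/-!
Write `E_w` for the evaluation `[f; g] ↦ f(w)` on the scattering space, and `P_S` for the orthogonal
projection onto `S`. The kernel of a closed subspace `S` of `𝒦_Φ` is `(z, w) ↦ E_z P_S E_w*`
(`kernelOf_apply`), so orthogonal decompositions of `𝒦_Φ` turn into sums of kernels. Two
computations connect this with Agler kernels. For `S ⊆ 𝒦_Φ` invariant under the
isometry `Z_j`, the identity `P_{S ⊖ Z_j S} = P_S - Z_j P_S Z_j*` shows that the kernel of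
`S ⊖ Z_j S` is `1 - z_j w̄_j` times that of `S` (`kernelOf_wandering`). And the kernel of `𝒦_Φ` is
`(I - Φ(z) Φ(w)*) / ((1 - z₁ w̄₁)(1 - z₂ w̄₂))` (`kernelOf_scatteringSubspace`), so that `(K₁, K₂)` is
a pair of Agler kernels exactly when the positive kernels `A_j = K_j / (1 - z_j w̄_j)` add up to the
kernel of `𝒦_Φ` (`isAglerPair_iff`).

In terms of Fourier supports, `𝒦_Φ` consists of the `[f; g]` with `f ∈ H²` and `g ⊥ H²`, and
`S_j^max` of those for which `g` has only negative frequencies in the other variable (`mem_Smax`).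
It follows that `S_j^max` is the complement of `S_i^min` in `𝒦_Φ` for `i ≠ j` (`Smax_eq`), and that
`S_j^min` is a `Z_j`-invariant subspace of `S_j^max` (`Smin_le_Smax`, `mulZ_mem_Smin`). Hence
`𝒦_Φ = S_1^min ⊕ S_2^min ⊕ ℛ`, which is the formula for `G`, and which also shows that the
`K_j^min + (1 - z_j w̄_j) G_j` with `G₁ + G₂ = G` are Agler kernels.

For the converse one has to see that `A_i` dominates the kernel of `S_i^min`; equivalently, that
`A_j` is dominated by the kernel of `S_j^max` (`isPositiveKernel_kernelOf_Smax_sub`). If `f` belongs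
to the reproducing kernel Hilbert space of `A_j`, then so do all `z_j^k f`, with no larger norms,
because `(1 - z_j w̄_j) A_j` is positive. As `A_j` is dominated by the kernel of `𝒦_Φ`, each `z_j^k f`
is the first component of some `u_k ∈ 𝒦_Φ` with `‖u_k‖ ≤ ‖f‖`. A weak limit of `(Z_j*)^k u_k` is an
element of `S_j^max` with first component `f` and norm at most `‖f‖` (`exists_mem_Smax`).
-/

noncomputable section

open MeasureTheory Set Complex
open scoped Real InnerProductSpace ComplexOrder

set_option linter.unusedSectionVars false

universe u v

namespace BidiskAgler

/-! ### Power series on the bidisk -/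

theorem hasSum_geometric_prod {𝕜 : Type*} [NormedField 𝕜] [CompleteSpace 𝕜] {a : Fin 2 → 𝕜}
    (ha : ∀ i, ‖a i‖ < 1) :
    HasSum (fun n : Fin 2 → ℕ => ∏ i, a i ^ n i) (∏ i, (1 - a i)⁻¹) := by
  have h0 := hasSum_geometric_of_norm_lt_one (ha 0)
  have h1 := hasSum_geometric_of_norm_lt_one (ha 1)
  have hs : Summable fun p : ℕ × ℕ => a 0 ^ p.1 * a 1 ^ p.2 :=
    summable_mul_of_summable_norm (summable_norm_geometric_of_norm_lt_one (ha 0))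
      (summable_norm_geometric_of_norm_lt_one (ha 1))
  have h := h0.mul h1 hs
  rw [← (finTwoArrowEquiv ℕ).hasSum_iff] at h
  simpa [Fin.prod_univ_two, Function.comp_def, mul_comm] using h

theorem eq_zero_of_hasSum_pow_smul {V : Type*} [NormedAddCommGroup V] [NormedSpace ℂ V]
    {c : ℕ → V} (h : ∀ z : ℂ, ‖z‖ < 1 → HasSum (fun n => z ^ n • c n) 0) : c = 0 := by
  let p : FormalMultilinearSeries ℂ ℂ V := fun n =>
    ContinuousMultilinearMap.mkPiRing ℂ (Fin n) (c n)
  have hp : HasFPowerSeriesAt (fun _ : ℂ => (0 : V)) p 0 := by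
    refine hasFPowerSeriesAt_iff.2 ?_
    filter_upwards [Metric.ball_mem_nhds (0 : ℂ) one_pos] with z hz
    simpa [p, FormalMultilinearSeries.coeff] using h z (by simpa using hz)
  have h0 := hp.eq_zero
  funext n
  have := congrFun h0 n
  have h2 := congrArg (fun q => q fun _ => (1 : ℂ)) this
  simpa [p] using h2

/-- A power series with bounded coefficients which vanishes on the bidisk is zero. -/
theorem eq_zero_of_hasSum_bidisk {V : Type*} [NormedAddCommGroup V] [NormedSpace ℂ V]
    [CompleteSpace V] {c : (Fin 2 → ℕ) → V} {C : ℝ} (hC : ∀ n, ‖c n‖ ≤ C)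
    (h : ∀ z ∈ bidisk, HasSum (fun n : Fin 2 → ℕ => (∏ i, z i ^ n i) • c n) 0) : c = 0 := by
  -- fix the second variable and sum over the second index to reduce to one variable
  have hsum : ∀ b : ℂ, ‖b‖ < 1 → ∀ k, Summable fun l => b ^ l • c ![k, l] := fun b hb k =>
    Summable.of_norm_bounded ((summable_geometric_of_lt_one (norm_nonneg b) hb).mul_right C)
      fun l => by
        rw [norm_smul, norm_pow]
        exact mul_le_mul_of_nonneg_left (hC _) (by positivity)
  have key : ∀ b : ℂ, ‖b‖ < 1 → (fun k => ∑' l, b ^ l • c ![k, l]) = 0 := fun b hb => by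
    refine eq_zero_of_hasSum_pow_smul fun a ha => ?_
    have h1 := h ![a, b] (by simp [bidisk, Fin.forall_fin_two, ha, hb])
    rw [← (finTwoArrowEquiv ℕ).symm.hasSum_iff] at h1
    have h2 := h1.prod_fiberwise (g := fun k => a ^ k • ∑' l, b ^ l • c ![k, l]) fun k => by
      have := (hsum b hb k).hasSum.const_smul (a ^ k)
      simpa [Function.comp_def, finTwoArrowEquiv, smul_smul, Fin.prod_univ_two] using this
    exact h2
  funext n
  have h3 : (fun l => c ![n 0, l]) = 0 := eq_zero_of_hasSum_pow_smul fun b hb => by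
    have h4 := (hsum b hb (n 0)).hasSum
    have h5 := congrFun (key b hb) (n 0)
    simp only [Pi.zero_apply] at h5
    rwa [h5] at h4
  have h6 := congrFun h3 (n 1)
  have h7 : ![n 0, n 1] = n := by ext i; fin_cases i <;> rfl
  simpa [h7] using h6

/-! ### The Taylor coefficients of a Schur function -/

section Coefficients

variable {E F : Type*} [NormedAddCommGroup E] [InnerProductSpace ℂ E] [CompleteSpace E]
  [NormedAddCommGroup F] [InnerProductSpace ℂ F] [CompleteSpace F]

namespace SchurClass
variable (Φ : SchurClass E F)

theorem coeff_eq_zero {n : Fin 2 → ℤ} (hn : ¬ 0 ≤ n) : Φ.coeff n = 0 := by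
  obtain ⟨p, hi⟩ : ∃ p : Fin 2, n (p.succAbove 0) < 0 := by
    by_contra! h
    exact hn fun i => by fin_cases i; exacts [h 1, h 0]
  have hR : ∀ i : Fin 2, (0 : ℝ) < (fun _ => 1 / 2 : Fin 2 → ℝ) i ∧
      (fun _ => 1 / 2 : Fin 2 → ℝ) i < 1 := fun i => by norm_num
  rw [coeff, torusIntegral_succAbove (Φ.torusIntegrable_coeff n hR) p]
  refine smul_eq_zero_of_right _ ?_
  refine Eq.trans (circleIntegral.integral_congr (g := fun _ => 0) (by norm_num) fun x hx => ?_)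
    (by simp [circleIntegral])
  have hx : ‖x‖ = 1 / 2 := by simpa using hx
  simp only [torusIntegral_dim1]
  obtain ⟨k, hk⟩ : ∃ k : ℕ, -(n (p.succAbove 0) + 1) = k :=
    ⟨(-(n (p.succAbove 0) + 1)).toNat, by omega⟩
  -- in the variable with the negative exponent the integrand is holomorphic on the disk
  have hd : DifferentiableOn ℂ (fun z : ℂ => (x ^ (-(n p + 1)) * z ^ k) •
      Φ.toFun (p.insertNth (α := fun _ => ℂ) x fun _ => z)) {z | ‖z‖ < 1} := by
    have hpow : DifferentiableOn ℂ (fun z : ℂ => x ^ (-(n p + 1)) * z ^ k) {z | ‖z‖ < 1} := by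
      fun_prop
    refine hpow.smul (Φ.differentiableOn.comp
      (f := fun z : ℂ => p.insertNth (α := fun _ => ℂ) x fun _ => z) ?_ ?_)
    · refine differentiableOn_pi.2 fun j => ?_
      induction j using p.succAboveCases with
      | x => simp
      | p j => simp only [Fin.insertNth_apply_succAbove]; fun_prop
    · intro z hz j
      induction j using p.succAboveCases with
      | x => simp [hx]; norm_num
      | p j => simpa using hz
  have hsub : Metric.closedBall (0 : ℂ) (1 / 2) ⊆ {z | ‖z‖ < 1} := fun z hz => by
    have : ‖z‖ ≤ 1 / 2 := by simpa using hz
    exact this.trans_lt (by norm_num)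
  have h0 : (∮ z in C(0, 1 / 2), (x ^ (-(n p + 1)) * z ^ k) •
      Φ.toFun (p.insertNth (α := fun _ => ℂ) x fun _ => z)) = 0 := by
    refine DiffContOnCl.circleIntegral_eq_zero (by norm_num) (hd.mono ?_).diffContOnCl
    rw [closure_ball _ (by norm_num)]
    exact hsub
  refine Eq.trans (circleIntegral.integral_congr (by norm_num) fun z _ => ?_) h0
  simp only [Fin.prod_univ_succAbove _ p, Fin.insertNth_apply_same, Fin.insertNth_apply_succAbove,
    Finset.univ_unique, Finset.prod_singleton, Fin.default_eq_zero, hk, zpow_natCast]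

/-- Cauchy's integral formula on the bidisk. -/
theorem torusIntegral_cauchy {w : Fin 2 → ℂ} {r : ℝ} (hw : ∀ i, ‖w i‖ < r) (hr1 : r < 1) :
    torusIntegral (fun z => (∏ i, (z i - w i)⁻¹) • Φ.toFun z) 0 (fun _ => r)
      = (2 * π * I : ℂ) ^ 2 • Φ.toFun w := by
  have hr0 : 0 < r := (norm_nonneg _).trans_lt (hw 0)
  have hne : ∀ i (x : ℂ), r ≤ ‖x‖ → x - w i ≠ 0 := fun i x hx h => by
    rw [sub_eq_zero] at h
    exact absurd (hw i) (by rw [← h]; exact not_lt.2 hx)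
  have hint : TorusIntegrable (fun z => (∏ i, (z i - w i)⁻¹) • Φ.toFun z) 0 (fun _ => r) := by
    have hmem : ∀ θ, torusMap 0 (fun _ : Fin 2 => r) θ ∈ bidisk := fun θ =>
      (torusMap_mem (fun _ => ⟨hr0, hr1⟩) θ).1
    have hc : Continuous (torusMap 0 (fun _ : Fin 2 => r)) := by unfold torusMap; fun_prop
    refine integrable_torus (Continuous.fun_smul ?_ (Φ.differentiableOn.continuousOn.comp_continuous
      hc hmem))
    refine continuous_finsetProd _ fun i _ => Continuous.inv₀ (by fun_prop) fun θ => ?_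
    refine hne i _ ?_
    simp [torusMap, norm_exp_ofReal_mul_I, abs_of_pos hr0]
  rw [torusIntegral_succAbove hint 0]
  have hdiff : ∀ a b : ℂ → ℂ, Differentiable ℂ a → Differentiable ℂ b →
      ∀ s : Set ℂ, (∀ z ∈ s, ‖a z‖ < 1 ∧ ‖b z‖ < 1) →
      DifferentiableOn ℂ (fun z => Φ.toFun ![a z, b z]) s := fun a b ha hb s hs => by
    refine Φ.differentiableOn.comp (f := fun z => ![a z, b z]) ?_ fun z hz i => ?_
    · refine differentiableOn_pi.2 fun j => ?_
      fin_cases j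
      exacts [ha.differentiableOn, hb.differentiableOn]
    · fin_cases i
      exacts [(hs z hz).1, (hs z hz).2]
  have hcl : ∀ z ∈ closure (Metric.ball (0 : ℂ) r), ‖z‖ < 1 := fun z hz => by
    rw [closure_ball _ hr0.ne'] at hz
    exact (by simpa using hz : ‖z‖ ≤ r).trans_lt hr1
  have inner : ∀ x : ℂ, x ∈ Metric.sphere (0 : ℂ) r →
      (torusIntegral (fun y : Fin 1 → ℂ => (∏ i, ((Fin.insertNth (α := fun _ => ℂ) 0 x y : Fin 2 → ℂ) i - w i)⁻¹) •
        Φ.toFun (Fin.insertNth (α := fun _ => ℂ) 0 x y)) 0 fun _ => r)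
      = (x - w 0)⁻¹ • (2 * π * I : ℂ) • Φ.toFun ![x, w 1] := fun x hx => by
    have hx : ‖x‖ = r := by simpa using hx
    have hc1 := (hdiff (fun _ => x) id (by fun_prop) (by fun_prop) _
      fun z hz => ⟨by simpa [hx] using hr1, hcl z hz⟩).diffContOnCl.circleIntegral_sub_inv_smul
      (w := w 1) (by simpa using hw 1)
    simp only [id] at hc1
    rw [torusIntegral_dim1, ← hc1, ← circleIntegral.integral_smul]
    refine circleIntegral.integral_congr hr0.le fun z _ => ?_
    have hz : (Fin.insertNth (α := fun _ => ℂ) 0 x fun _ : Fin 1 => z) = ![x, z] := by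
      ext i; fin_cases i <;> rfl
    simp only [hz, smul_smul]
    exact congrArg (· • _) (Fin.prod_univ_two _)
  have hc2 := (hdiff id (fun _ => w 1) (by fun_prop) (by fun_prop) _
      fun z hz => ⟨hcl z hz, (hw 1).trans hr1⟩).diffContOnCl.circleIntegral_sub_inv_smul
      (w := w 0) (by simpa using hw 0)
  have hw2 : ![w 0, w 1] = w := by ext i; fin_cases i <;> rfl
  simp only [id] at hc2
  rw [hw2] at hc2
  rw [sq, mul_smul, ← hc2, ← circleIntegral.integral_smul]
  refine circleIntegral.integral_congr hr0.le fun x hx => ?_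
  refine Eq.trans (inner x hx) ?_
  exact smul_comm _ _ _

/-- A Schur function is the sum of its Taylor series on the bidisk. -/
theorem hasSum_coeff {w : Fin 2 → ℂ} (hw : w ∈ bidisk) :
    HasSum (fun n : Fin 2 → ℕ => (∏ i, w i ^ n i) • Φ.coeff fun i => (n i : ℤ)) (Φ.toFun w) := by
  obtain ⟨r, hr, hr1⟩ : ∃ r, max (1 / 2) (max ‖w 0‖ ‖w 1‖) < r ∧ r < 1 :=
    exists_between (max_lt (by norm_num) (max_lt (hw 0) (hw 1)))
  simp only [max_lt_iff] at hr
  have hr0 : 0 < r := by linarith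
  have hwr : ∀ i, ‖w i‖ < r := by simp [Fin.forall_fin_two, hr]
  have hpi : ((2 * π * I : ℂ) ^ 2) ≠ 0 := by simp [Real.pi_ne_zero]
  have hmem : ∀ θ, torusMap 0 (fun _ : Fin 2 => r) θ ∈ bidisk := fun θ =>
    (torusMap_mem (fun _ => ⟨hr0, hr1⟩) θ).1
  have hnorm : ∀ θ i, ‖torusMap 0 (fun _ : Fin 2 => r) θ i‖ = r := fun θ i => by
    simp [torusMap, norm_exp_ofReal_mul_I, abs_of_pos hr0]
  have hne : ∀ θ i, torusMap 0 (fun _ : Fin 2 => r) θ i ≠ 0 := fun θ i =>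
    (torusMap_mem (fun _ => ⟨hr0, hr1⟩) θ).2 i
  have hg := hasSum_geometric_prod (a := fun i => ‖w i‖ / r) (fun i => by
    rw [norm_div, norm_norm, Real.norm_of_nonneg hr0.le, div_lt_one hr0]; exact hwr i)
  -- integrate the geometric expansion of the Cauchy kernel term by term
  have key : HasSum (fun n : Fin 2 → ℕ => torusIntegral (fun z => (∏ i, w i ^ n i) •
      (∏ i, z i ^ (-((n i : ℤ) + 1))) • Φ.toFun z) 0 fun _ => r)
      (torusIntegral (fun z => (∏ i, (z i - w i)⁻¹) • Φ.toFun z) 0 (fun _ => r)) := by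
    refine hasSum_integral_of_dominated_convergence
      (fun n _ => ∏ i, (‖w i‖ / r) ^ n i) (fun n => ?_) (fun n => ?_) ?_ ?_ ?_
    · have h := (Φ.torusIntegrable_coeff (fun i => (n i : ℤ)) (R := fun _ => r)
        fun _ => ⟨hr0, hr1⟩).function_integrable.smul (∏ i, w i ^ n i)
      refine h.aestronglyMeasurable.congr (Filter.Eventually.of_forall fun θ => ?_)
      simp only [Pi.smul_apply]
      rw [smul_comm]
    · refine Filter.Eventually.of_forall fun θ => ?_
      have h1 := Φ.norm_le_one _ (hmem θ)
      rw [norm_smul, norm_smul, norm_smul]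
      simp only [norm_zpow, norm_pow, hnorm, norm_mul, norm_I, norm_exp_ofReal_mul_I,
        Complex.norm_real, Real.norm_of_nonneg hr0.le, Fin.prod_univ_two]
      have e : ∀ k : ℕ, r ^ (-((k : ℤ) + 1)) = (r ^ k)⁻¹ * r⁻¹ := fun k => by
        rw [neg_add, zpow_add₀ hr0.ne']; simp
      rw [e, e, div_pow, div_pow]
      have hr0' := hr0.ne'
      have : r * 1 * 1 * (r * 1 * 1) * (‖w 0‖ ^ n 0 * ‖w 1‖ ^ n 1 *
          ((r ^ n 0)⁻¹ * r⁻¹ * ((r ^ n 1)⁻¹ * r⁻¹) * ‖Φ.toFun (torusMap 0 (fun x => r) θ)‖))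
          = ‖w 0‖ ^ n 0 / r ^ n 0 * (‖w 1‖ ^ n 1 / r ^ n 1) *
            ‖Φ.toFun (torusMap 0 (fun x => r) θ)‖ := by field_simp
      rw [this]
      exact mul_le_of_le_one_right (by positivity) h1
    · exact Filter.Eventually.of_forall fun _ => hg.summable
    · exact integrable_torus continuous_const
    · refine Filter.Eventually.of_forall fun θ => ?_
      refine HasSum.const_smul _ ?_
      have h2 := hasSum_geometric_prod (a := fun i => w i / torusMap 0 (fun _ => r) θ i) fun i => by
        rw [norm_div, hnorm, div_lt_one hr0]; exact hwr i
      have h3 := (h2.mul_left (∏ i, (torusMap 0 (fun _ => r) θ i)⁻¹)).smul_const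
        (Φ.toFun (torusMap 0 (fun _ => r) θ))
      refine (congrArg₂ HasSum (funext fun n => ?_) ?_).mpr h3
      · change (∏ i, w i ^ n i) • (∏ i, torusMap 0 (fun _ => r) θ i ^ (-((n i : ℤ) + 1))) •
          Φ.toFun (torusMap 0 (fun _ => r) θ) = _
        rw [smul_smul, ← Finset.prod_mul_distrib, ← Finset.prod_mul_distrib]
        congr 1
        refine Finset.prod_congr rfl fun i _ => ?_
        have := hne θ i
        rw [neg_add, zpow_add₀ this, div_pow]
        simp
        field_simp
      · refine congrArg (· • Φ.toFun (torusMap 0 (fun _ => r) θ)) ?_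
        rw [← Finset.prod_mul_distrib]
        refine Finset.prod_congr rfl fun i _ => ?_
        rw [← mul_inv, mul_sub, mul_one, mul_div_cancel₀ _ (hne θ i)]
  rw [Φ.torusIntegral_cauchy hwr hr1] at key
  have h4 := key.const_smul (((2 * π * I : ℂ) ^ 2)⁻¹)
  rw [smul_smul, inv_mul_cancel₀ hpi, one_smul] at h4
  convert! h4 using 2 with n
  rw [torusIntegral_smul, smul_comm, coeff, Φ.torusIntegral_radius _ hr.1.le hr1]

end SchurClass
end Coefficients

/-! ### Functions with restricted Fourier support -/

theorem eq_or_eq_of_ne {i j : Fin 2} (hij : i ≠ j) (l : Fin 2) : l = i ∨ l = j := by omega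

section Support

variable {E F : Type*} [NormedAddCommGroup E] [InnerProductSpace ℂ E] [CompleteSpace E]
  [NormedAddCommGroup F] [InnerProductSpace ℂ F] [CompleteSpace F]

theorem single_mem_suppIn {N : Set (Fin 2 → ℤ)} {m : Fin 2 → ℤ} (hm : m ∈ N) (x : E) :
    (lp.single 2 m x : L2 E) ∈ suppIn N := fun n hn => by
  rw [lp.single_apply, Pi.single_apply, if_neg]
  rintro rfl
  exact hn hm

theorem suppIn_mono {N N' : Set (Fin 2 → ℤ)} (h : N ⊆ N') :
    (suppIn N : Submodule ℂ (L2 E)) ≤ suppIn N' := fun _ hf n hn => hf n fun h' => hn (h h')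

theorem hasSum_single_L2 (f : L2 E) : HasSum (fun n => (lp.single 2 n (f n) : L2 E)) f :=
  lp.hasSum_single (E := fun _ : Fin 2 → ℤ => E) (p := 2) (by simp) f

/-- Two operators agreeing on the monomials with exponent in `N` agree on `suppIn N`. -/
theorem eq_on_suppIn {V : Type*} [NormedAddCommGroup V] [NormedSpace ℂ V] {A B : L2 E →L[ℂ] V}
    {N : Set (Fin 2 → ℤ)} (h : ∀ m ∈ N, ∀ x, A (lp.single 2 m x) = B (lp.single 2 m x))
    {f : L2 E} (hf : f ∈ suppIn N) : A f = B f := by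
  refine ((hasSum_single_L2 f).mapL A).unique ?_
  refine (congrArg (HasSum · _) (funext fun m => ?_)).mp ((hasSum_single_L2 f).mapL B)
  by_cases hm : m ∈ N
  · exact (h m hm _).symm
  · rw [hf m hm, lp.single_zero, map_zero, map_zero]

theorem inner_single (m : Fin 2 → ℤ) (x : E) (f : L2 E) :
    inner ℂ (lp.single 2 m x : L2 E) f = inner ℂ x (f m) :=
  lp.inner_single_left (G := fun _ : Fin 2 → ℤ => E) m x f

theorem mem_suppIn_iff_inner {N : Set (Fin 2 → ℤ)} {f : L2 E} :
    f ∈ suppIn N ↔ ∀ g ∈ (suppIn Nᶜ : Submodule ℂ (L2 E)), inner ℂ g f = 0 := by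
  refine ⟨fun hf g hg => ?_, fun h n hn => ?_⟩
  · rw [lp.inner_eq_tsum]
    refine (tsum_congr fun n => ?_).trans tsum_zero
    by_cases hn : n ∈ N
    · rw [hg n (not_not.2 hn), inner_zero_left]
    · rw [hf n hn, inner_zero_right]
  · refine ext_inner_left ℂ fun x => ?_
    rw [← inner_single, h _ (single_mem_suppIn hn x), inner_zero_right]

theorem suppIn_orthogonal (N : Set (Fin 2 → ℤ)) :
    (suppIn N : Submodule ℂ (L2 E))ᗮ = suppIn Nᶜ := by
  ext f
  rw [Submodule.mem_orthogonal, mem_suppIn_iff_inner, compl_compl]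

theorem isClosed_suppIn (N : Set (Fin 2 → ℤ)) : 
    IsClosed ((suppIn N : Submodule ℂ (L2 E)) : Set (L2 E)) := by
  rw [← compl_compl N, ← suppIn_orthogonal]
  exact Submodule.isClosed_orthogonal _

instance (N : Set (Fin 2 → ℤ)) : CompleteSpace (suppIn N : Submodule ℂ (L2 E)) :=
  (isClosed_suppIn N).completeSpace_coe

theorem H2_orthogonal : (H2 E)ᗮ = suppIn {n : Fin 2 → ℤ | ∀ i, 0 ≤ n i}ᶜ := suppIn_orthogonal _

instance : (H2 E).HasOrthogonalProjection :=
  inferInstanceAs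
    (suppIn {n : Fin 2 → ℤ | ∀ i, 0 ≤ n i} : Submodule ℂ (L2 E)).HasOrthogonalProjection

namespace SchurClass
variable (Φ : SchurClass E F)

/-- Multiplication by an analytic function only moves Fourier supports upwards. -/
theorem mulOp_mem_suppIn {N : Set (Fin 2 → ℤ)} (hN : IsUpperSet N) {f : L2 E}
    (hf : f ∈ suppIn N) : Φ.mulOp f ∈ suppIn N := fun n hn => by
  refine eq_on_suppIn (A := lp.evalCLM ℂ (fun _ : Fin 2 → ℤ => F) 2 n ∘L Φ.mulOp) (B := 0)
    (fun m hm x => ?_) hf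
  refine (Φ.mulOp_single m n x).trans ?_
  rw [Φ.coeff_eq_zero fun h => hn (hN (sub_nonneg.1 h) hm)]
  rfl

theorem adjoint_mulOp_mem_suppIn {N : Set (Fin 2 → ℤ)} (hN : IsLowerSet N) {f : L2 F}
    (hf : f ∈ suppIn N) : Φ.mulOp.adjoint f ∈ suppIn N :=
  mem_suppIn_iff_inner.2 fun g hg => by
    rw [ContinuousLinearMap.adjoint_inner_right]
    exact mem_suppIn_iff_inner.1 hf _ (Φ.mulOp_mem_suppIn hN.compl hg)

end SchurClass

theorem isUpperSet_nonneg : IsUpperSet {n : Fin 2 → ℤ | ∀ i, 0 ≤ n i} :=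
  fun _ _ h hn i => (hn i).trans (h i)

theorem shift_mem_suppIn_iff {j : Fin 2} {N N' : Set (Fin 2 → ℤ)}
    (h : ∀ n, n + Pi.single j 1 ∈ N' ↔ n ∈ N) {f : L2 E} :
    shift j f ∈ suppIn N' ↔ f ∈ suppIn N := by
  refine ⟨fun hf n hn => ?_, fun hf n hn => ?_⟩
  · have := hf (n + Pi.single j 1) (by rwa [h])
    rwa [shift_apply, add_sub_cancel_right] at this
  · rw [shift_apply]
    exact hf _ (by rwa [← h, sub_add_cancel])

theorem shift_mem_H2 (j : Fin 2) {f : L2 E} (hf : f ∈ H2 E) : shift j f ∈ H2 E := fun n hn => by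
  rw [shift_apply]
  refine hf _ fun h => hn fun i => (h i).trans ?_
  rw [Pi.sub_apply, sub_le_self_iff, Pi.single_apply]
  split_ifs <;> simp

theorem inner_iterate_shift (j : Fin 2) (k : ℕ) (f g : L2 E) :
    inner ℂ ((shift j)^[k] f) ((shift j)^[k] g) = inner ℂ f g := by
  induction k with
  | zero => rfl
  | succ k ih =>
    rw [Function.iterate_succ_apply', Function.iterate_succ_apply', LinearIsometry.inner_map_map, ih]

theorem iterate_shift_single (j : Fin 2) (k : ℕ) (m : Fin 2 → ℤ) (x : E) :
    (shift j)^[k] (lp.single 2 m x : L2 E) = lp.single 2 (m + Pi.single j (k : ℤ)) x := by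
  induction k with
  | zero => simp
  | succ k ih =>
    rw [Function.iterate_succ_apply', ih, shift_single, add_assoc, ← Pi.single_add, Nat.cast_succ]

theorem iterate_shift_mem_H2 (j : Fin 2) (k : ℕ) {f : L2 E} (hf : f ∈ H2 E) :
    (shift j)^[k] f ∈ H2 E := by
  induction k with
  | zero => exact hf
  | succ k ih => rw [Function.iterate_succ_apply']; exact shift_mem_H2 j ih

theorem iterate_shift_apply (j : Fin 2) (k : ℕ) (f : L2 E) (n : Fin 2 → ℤ) :
    (shift j)^[k] f n = f (n - Pi.single j (k : ℤ)) := by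
  induction k generalizing n with
  | zero => simp
  | succ k ih =>
    rw [Function.iterate_succ_apply', shift_apply, ih, sub_sub, ← Pi.single_add, add_comm (1 : ℤ),
      Nat.cast_succ]

end Support

/-! ### Point evaluations on the Hardy space -/

section Evaluation

variable {E F : Type*} [NormedAddCommGroup E] [InnerProductSpace ℂ E] [CompleteSpace E]
  [NormedAddCommGroup F] [InnerProductSpace ℂ F] [CompleteSpace F]

theorem mem_nonneg_iff {m : Fin 2 → ℤ} :
    m ∈ {n : Fin 2 → ℤ | ∀ i, 0 ≤ n i} ↔ ∃ k : Fin 2 → ℕ, m = fun i => (k i : ℤ) :=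
  ⟨fun h => ⟨fun i => (m i).toNat, funext fun i => (Int.toNat_of_nonneg (h i)).symm⟩, by
    rintro ⟨k, rfl⟩ i
    exact Int.natCast_nonneg _⟩

theorem natCast_comp_injective :
    Function.Injective fun (k : Fin 2 → ℕ) (i : Fin 2) => (k i : ℤ) := fun _ _ h =>
  funext fun i => Int.ofNat_injective (congrFun h i)

theorem evalAt_single (w : bidisk) (m : Fin 2 → ℕ) (x : E) :
    evalAt E w (lp.single 2 (fun i => (m i : ℤ)) x) = (∏ i, w.1 i ^ m i) • x := by
  have h := hasSum_evalAt w (lp.single 2 (fun i => (m i : ℤ)) x : L2 E)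
  refine h.unique ?_
  convert hasSum_single m fun n hn => ?_ using 1
  · rw [lp.single_apply_self]
  · rw [lp.single_apply_ne, smul_zero]
    exact fun h => hn (natCast_comp_injective h)

theorem evalAt_single_of_not_nonneg (w : bidisk) {m : Fin 2 → ℤ}
    (hm : m ∉ {n : Fin 2 → ℤ | ∀ i, 0 ≤ n i}) (x : E) :
    evalAt E w (lp.single 2 m x) = 0 := by
  refine (hasSum_evalAt w (lp.single 2 m x : L2 E)).unique ?_
  convert hasSum_zero using 2 with n
  rw [lp.single_apply_ne, smul_zero]
  exact fun h => hm (mem_nonneg_iff.2 ⟨n, h.symm⟩)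

theorem evalAt_shift (w : bidisk) (j : Fin 2) {f : L2 E} (hf : f ∈ H2 E) :
    evalAt E w (shift j f) = w.1 j • evalAt E w f := by
  refine eq_on_suppIn (A := evalAt E w ∘L (shift j).toContinuousLinearMap)
    (B := w.1 j • evalAt E w) (fun m hm x => ?_) hf
  obtain ⟨k, rfl⟩ := mem_nonneg_iff.1 hm
  change evalAt E w (shift j (lp.single 2 _ x)) = w.1 j • evalAt E w (lp.single 2 _ x)
  have : (fun i => (k i : ℤ)) + Pi.single j 1 = fun i => ((k + Pi.single j 1 : Fin 2 → ℕ) i : ℤ) := by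
    ext i
    by_cases h : i = j
    · subst h; simp
    · simp [h]
  rw [shift_single, this, evalAt_single, evalAt_single, smul_smul]
  congr 1
  simp only [Pi.add_apply, pow_add, Finset.prod_mul_distrib, mul_comm (w.1 j)]
  congr 1
  rw [Finset.prod_eq_single j] <;> simp +contextual

theorem evalAt_iterate_shift (w : bidisk) (j : Fin 2) (k : ℕ) {f : L2 E} (hf : f ∈ H2 E) :
    evalAt E w ((shift j)^[k] f) = w.1 j ^ k • evalAt E w f := by
  induction k with
  | zero => simp
  | succ k ih =>
    rw [Function.iterate_succ_apply', evalAt_shift w j (iterate_shift_mem_H2 j k hf), ih,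
      smul_smul, pow_succ']

/-- Multiplication by `Φ` on the Hardy space is pointwise multiplication. -/
theorem evalAt_mulOp (Φ : SchurClass E F) (w : bidisk) {f : L2 E} (hf : f ∈ H2 E) :
    evalAt F w (Φ.mulOp f) = Φ.toFun w (evalAt E w f) := by
  refine eq_on_suppIn (A := evalAt F w ∘L Φ.mulOp) (B := Φ.toFun w ∘L evalAt E w)
    (fun m hm x => ?_) hf
  obtain ⟨k, rfl⟩ := mem_nonneg_iff.1 hm
  change evalAt F w (Φ.mulOp (lp.single 2 _ x)) = Φ.toFun w (evalAt E w (lp.single 2 _ x))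
  rw [evalAt_single, map_smul]
  have h1 := hasSum_evalAt w (Φ.mulOp (lp.single 2 (fun i => (k i : ℤ)) x))
  have h2 := ((Φ.hasSum_coeff w.2).mapL (ContinuousLinearMap.apply ℂ F x)).const_smul
    (∏ i, w.1 i ^ k i)
  refine h1.unique ?_
  have hinj : Function.Injective fun n : Fin 2 → ℕ => n + k := add_left_injective k
  rw [← hinj.hasSum_iff]
  · refine (congrArg (HasSum · _) (funext fun n => ?_)).mp h2
    change (∏ i, w.1 i ^ k i) • (∏ i, w.1 i ^ n i) • Φ.coeff _ x = _
    simp only [Function.comp_apply]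
    rw [Φ.mulOp_single, smul_smul, ← Finset.prod_mul_distrib]
    congr 1
    · exact Finset.prod_congr rfl fun i _ => by rw [Pi.add_apply, pow_add, mul_comm]
    · congr 2
      ext i
      simp
  · intro n hn
    rw [Φ.mulOp_single, Φ.coeff_eq_zero, zero_apply, smul_zero]
    refine fun h => hn ⟨n - k, funext fun i => Nat.sub_add_cancel ?_⟩
    have := h i
    simp only [Pi.zero_apply, Pi.sub_apply, sub_nonneg] at this
    exact_mod_cast this

theorem adjoint_evalAt_mem_H2 (w : bidisk) (η : E) : (evalAt E w).adjoint η ∈ H2 E :=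
  fun n hn => ext_inner_left ℂ fun x => by
    rw [← inner_single, ContinuousLinearMap.adjoint_inner_right,
      evalAt_single_of_not_nonneg w hn, inner_zero_left, inner_zero_right]

theorem adjoint_evalAt_apply (w : bidisk) (η : E) (n : Fin 2 → ℕ) :
    (evalAt E w).adjoint η (fun i => (n i : ℤ)) = (∏ i, (starRingEnd ℂ) (w.1 i) ^ n i) • η :=
  ext_inner_left ℂ fun x => by
    rw [← inner_single, ContinuousLinearMap.adjoint_inner_right, evalAt_single, inner_smul_left,
      inner_smul_right]
    simp

/-- The Szegő kernel of the bidisk. -/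
theorem evalAt_adjoint_evalAt (z w : bidisk) (η : E) :
    evalAt E z ((evalAt E w).adjoint η)
      = (∏ i, (1 - z.1 i * (starRingEnd ℂ) (w.1 i))⁻¹) • η := by
  refine (hasSum_evalAt z _).unique ?_
  have h := (hasSum_geometric_prod (a := fun i => z.1 i * (starRingEnd ℂ) (w.1 i)) fun i => by
    rw [norm_mul, RCLike.norm_conj]
    exact mul_lt_one_of_nonneg_of_lt_one_left (norm_nonneg _) (z.2 i) (w.2 i).le).smul_const η
  refine (congrArg (HasSum · _) (funext fun n => ?_)).mp h
  rw [adjoint_evalAt_apply, smul_smul]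
  simp only [mul_pow, Finset.prod_mul_distrib]

theorem eq_of_evalAt_eq {f g : L2 E} (hf : f ∈ H2 E) (hg : g ∈ H2 E)
    (h : ∀ w : bidisk, evalAt E w f = evalAt E w g) : f = g := by
  rw [← sub_eq_zero]
  have hfg : f - g ∈ H2 E := sub_mem hf hg
  have h0 : (fun n : Fin 2 → ℕ => (f - g) fun i => (n i : ℤ)) = 0 :=
    eq_zero_of_hasSum_bidisk (C := ‖f - g‖) (fun n => lp.norm_apply_le_norm (by simp) _ _)
      fun z hz => by
        have := hasSum_evalAt ⟨z, hz⟩ (f - g)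
        rwa [map_sub, h, sub_self] at this
  ext m
  by_cases hm : m ∈ {n : Fin 2 → ℤ | ∀ i, 0 ≤ n i}
  · obtain ⟨k, rfl⟩ := mem_nonneg_iff.1 hm
    exact congrFun h0 k
  · exact hfg m hm

end Evaluation

/-! ### Operators and projections on Hilbert spaces -/

section Hilbert

variable {H : Type*} [NormedAddCommGroup H] [InnerProductSpace ℂ H] [CompleteSpace H]
  {H' : Type*} [NormedAddCommGroup H'] [InnerProductSpace ℂ H'] [CompleteSpace H']

/-- A form of weak sequential compactness: a bounded sequence has a weak cluster point `u`, and
`⟪x, u⟫` is the value of `⟪x, v k⟫` whenever the latter is eventually constant. -/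
theorem exists_inner_eq_of_eventually_eq {C : ℝ} {v : ℕ → H} (hv : ∀ k, ‖v k‖ ≤ C) :
    ∃ u, ‖u‖ ≤ C ∧ ∀ x c, (∀ᶠ k in Filter.atTop, inner ℂ x (v k) = c) → inner ℂ x u = c := by
  set φ : ℕ → WeakDual ℂ H := fun k => StrongDual.toWeakDual (InnerProductSpace.toDual ℂ H (v k))
  have hφ : ∀ k, φ k ∈ WeakDual.toStrongDual ⁻¹' Metric.closedBall (0 : StrongDual ℂ H) C :=
    fun k => by
      rw [mem_preimage, mem_closedBall_zero_iff]
      exact ((InnerProductSpace.toDual ℂ H).norm_map (v k)).trans_le (hv k)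
  obtain ⟨ψ, hψ, hlim⟩ := (WeakDual.isCompact_closedBall (𝕜 := ℂ) (E := H) 0 C).ultrafilter_le_nhds
    ((Filter.hyperfilter ℕ).map φ)
    (Filter.le_principal_iff.2 (Filter.mem_map.2 (Filter.univ_mem' hφ)))
  refine ⟨(InnerProductSpace.toDual ℂ H).symm (WeakDual.toStrongDual ψ), ?_, fun x c h => ?_⟩
  · rw [LinearIsometryEquiv.norm_map]
    simpa using hψ
  · have h1 : Filter.Tendsto (fun k => φ k x) (Filter.hyperfilter ℕ) (nhds (ψ x)) :=
      ((WeakDual.eval_continuous x).tendsto ψ).comp hlim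
    have h2 : ∀ᶠ k in (Filter.hyperfilter ℕ : Filter ℕ), φ k x = (starRingEnd ℂ) c := by
      refine Filter.Eventually.filter_mono Nat.hyperfilter_le_atTop (h.mono fun k hk => ?_)
      rw [← hk, inner_conj_symm]
      rfl
    have h3 : ψ x = (starRingEnd ℂ) c :=
      tendsto_nhds_unique h1 (tendsto_const_nhds.congr' (h2.mono fun k hk => hk.symm))
    rw [← inner_conj_symm, InnerProductSpace.toDual_symm_apply]
    exact (congrArg (starRingEnd ℂ) h3).trans (conj_conj c)

/-- Douglas' factorization of a map dominated in norm by another one. -/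
theorem exists_contraction_comp_eq {W : Type*} [AddCommGroup W] [Module ℂ W] (A : W →ₗ[ℂ] H)
    (B : W →ₗ[ℂ] H') (h : ∀ x, ‖B x‖ ≤ ‖A x‖) :
    ∃ T : H →L[ℂ] H', ‖T‖ ≤ 1 ∧ ∀ x, T (A x) = B x := by
  set S := (LinearMap.range A).topologicalClosure
  have : CompleteSpace S := (Submodule.isClosed_topologicalClosure _).completeSpace_coe
  have hS : ∀ x, A x ∈ S := fun x => Submodule.le_topologicalClosure _ ⟨x, rfl⟩
  set A' : W →ₗ[ℂ] S := A.codRestrict S hS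
  have hd : DenseRange A' := by
    rintro ⟨y, hy⟩
    rw [closure_subtype]
    refine closure_mono ?_ hy
    rintro _ ⟨x, rfl⟩
    exact ⟨A' x, ⟨x, rfl⟩, rfl⟩
  have hb : ∀ x, ‖B x‖ ≤ 1 * ‖A' x‖ := fun x => by rw [one_mul]; exact h x
  refine ⟨B.extendOfNorm A' ∘L S.orthogonalProjectionOnto, ?_, fun x => ?_⟩
  · refine ContinuousLinearMap.opNorm_le_bound _ zero_le_one fun y => ?_
    refine (LinearMap.norm_extendOfNorm_apply_le (f := B) (e := A') hd 1 hb _).trans ?_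
    rw [one_mul, one_mul]
    exact S.norm_orthogonalProjectionOnto_apply_le y
  · rw [ContinuousLinearMap.comp_apply]
    have : S.orthogonalProjectionOnto (A x) = A' x :=
      Submodule.orthogonalProjectionOnto_mem_subspace_eq_self (A' x)
    rw [this]
    exact LinearMap.extendOfNorm_eq (f := B) hd ⟨1, hb⟩ x

theorem starProjection_inf_orthogonal {S K : Submodule ℂ H} (h : S ≤ K)
    [S.HasOrthogonalProjection] [K.HasOrthogonalProjection] [(K ⊓ Sᗮ).HasOrthogonalProjection]
    (x : H) : (K ⊓ Sᗮ).starProjection x = K.starProjection x - S.starProjection x := by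
  refine Submodule.eq_starProjection_of_mem_orthogonal (K := K ⊓ Sᗮ) ⟨?_, ?_⟩ ?_
  · exact sub_mem (Submodule.starProjection_apply_mem _ _)
      (h (Submodule.starProjection_apply_mem _ _))
  · have e : K.starProjection x - S.starProjection x
        = (x - S.starProjection x) - (x - K.starProjection x) := by abel
    rw [e]
    exact sub_mem (Submodule.sub_starProjection_mem_orthogonal _)
      (Submodule.orthogonal_le h (Submodule.sub_starProjection_mem_orthogonal _))
  · have e : x - (K.starProjection x - S.starProjection x)
        = (x - K.starProjection x) + S.starProjection x := by abel
    rw [e]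
    refine add_mem (Submodule.orthogonal_le inf_le_left
      (Submodule.sub_starProjection_mem_orthogonal _)) ?_
    exact Submodule.orthogonal_le inf_le_right (Submodule.le_orthogonal_orthogonal _
      (Submodule.starProjection_apply_mem _ _))

/-- The Wold-type identity `P_{S ⊖ ZS} = P_S - Z P_S Z*` for an isometry `Z` leaving `S`
invariant. -/
theorem starProjection_wandering {Z : H →L[ℂ] H} (hZ : ∀ x, Z.adjoint (Z x) = x)
    {S : Submodule ℂ H} (hS : ∀ x ∈ S, Z x ∈ S) [S.HasOrthogonalProjection]
    [(S ⊓ (S.map (Z : H →ₗ[ℂ] H))ᗮ).HasOrthogonalProjection] (x : H) :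
    (S ⊓ (S.map (Z : H →ₗ[ℂ] H))ᗮ).starProjection x
      = S.starProjection x - Z (S.starProjection (Z.adjoint x)) := by
  refine Submodule.eq_starProjection_of_mem_orthogonal
    (K := S ⊓ (S.map (Z : H →ₗ[ℂ] H))ᗮ) ⟨?_, ?_⟩ ?_
  · exact sub_mem (Submodule.starProjection_apply_mem _ _)
      (hS _ (Submodule.starProjection_apply_mem _ _))
  · refine (Submodule.mem_orthogonal' _ _).2 ?_
    rintro _ ⟨s, hs, rfl⟩
    change inner ℂ _ (Z s) = 0
    rw [inner_sub_left, Submodule.inner_starProjection_left_eq_right,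
      Submodule.starProjection_eq_self_iff.2 (hS s hs), ← ContinuousLinearMap.adjoint_inner_left,
      ← ContinuousLinearMap.adjoint_inner_left, hZ,
      Submodule.inner_starProjection_left_eq_right, Submodule.starProjection_eq_self_iff.2 hs,
      sub_self]
  · have e : x - (S.starProjection x - Z (S.starProjection (Z.adjoint x)))
        = (x - S.starProjection x) + Z (S.starProjection (Z.adjoint x)) := by abel
    rw [e]
    refine add_mem (Submodule.orthogonal_le inf_le_left
      (Submodule.sub_starProjection_mem_orthogonal _)) ?_
    exact Submodule.orthogonal_le inf_le_right (Submodule.le_orthogonal_orthogonal _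
      ⟨_, Submodule.starProjection_apply_mem _ _, rfl⟩)

end Hilbert

/-! ### Positive kernels -/

section PositiveKernels

variable {Ω F : Type*} [NormedAddCommGroup F] [InnerProductSpace ℂ F] [CompleteSpace F]
  {H : Type*} [NormedAddCommGroup H] [InnerProductSpace ℂ H] [CompleteSpace H]

theorem sum_inner_adjoint_comp (κ : Ω → F →L[ℂ] H) {ι : Type*} (s : Finset ι) (x : ι → Ω)
    (η : ι → F) :
    ∑ i ∈ s, ∑ j ∈ s, inner ℂ (η i) (((κ (x i)).adjoint ∘L κ (x j)) (η j))
      = ((‖∑ i ∈ s, κ (x i) (η i)‖ ^ 2 : ℝ) : ℂ) := by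
  have := inner_self_eq_norm_sq_to_K (𝕜 := ℂ) (∑ i ∈ s, κ (x i) (η i))
  push_cast
  refine Eq.trans ?_ this
  simp only [sum_inner, inner_sum]
  refine Eq.trans ?_ Finset.sum_comm
  refine Finset.sum_congr rfl fun i _ => Finset.sum_congr rfl fun j _ => ?_
  exact ContinuousLinearMap.adjoint_inner_right _ _ _

namespace IsPositiveKernel

variable {K : Ω → Ω → (F →L[ℂ] F)}

theorem finsupp_sum_nonneg (hK : IsPositiveKernel K) (c : Ω →₀ F) :
    0 ≤ c.sum fun x u => c.sum fun y v => inner ℂ u (K x y v) := by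
  have h := hK c.support.card (fun i => (c.support.equivFin.symm i : Ω))
    (fun i => c (c.support.equivFin.symm i))
  rw [c.support.equivFin.symm.sum_comp
    (fun x : c.support => ∑ j, inner ℂ (c x) (K x (c.support.equivFin.symm j)
      (c (c.support.equivFin.symm j))))] at h
  have h2 : ∀ x : c.support, ∑ j, inner ℂ (c x) (K x (c.support.equivFin.symm j)
      (c (c.support.equivFin.symm j))) = ∑ y ∈ c.support, inner ℂ (c x) (K x y (c y)) := fun x => by
    rw [c.support.equivFin.symm.sum_comp (fun y : c.support => inner ℂ (c x) (K x y (c y)))]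
    exact c.support.sum_coe_sort fun y => inner ℂ (c x) (K x y (c y))
  simp_rw [h2] at h
  rwa [c.support.sum_coe_sort fun x => ∑ y ∈ c.support, inner ℂ (c x) (K x y (c y))] at h

theorem adjoint_eq (hK : IsPositiveKernel K) (x y : Ω) : (K x y).adjoint = K y x := by
  have key : ∀ u v : F, (inner ℂ u (K x y v) + inner ℂ v (K y x u)).im = 0 := fun u v => by
    have h := (Complex.le_def.1 (hK 2 ![x, y] ![u, v])).2
    have hu := (Complex.le_def.1 (hK 1 ![x] ![u])).2
    have hv := (Complex.le_def.1 (hK 1 ![y] ![v])).2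
    simp [Fin.sum_univ_two] at h hu hv
    simp only [add_im]
    linarith
  -- polarization: apply the previous identity to `v` and to `I • v`
  refine ContinuousLinearMap.ext fun u => ext_inner_left ℂ fun v => ?_
  rw [ContinuousLinearMap.adjoint_inner_right, ← inner_conj_symm (K x y v)]
  have h1 := key u v
  have h2 := key u (I • v)
  rw [map_smul, inner_smul_right, inner_smul_left] at h2
  simp only [add_im, conj_I, neg_mul, mul_im, I_re, I_im, neg_im, zero_mul, one_mul, zero_add]
    at h1 h2
  apply Complex.ext
  · rw [conj_re]; linarith
  · rw [conj_im]; linarith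

theorem posSemidef (hK : IsPositiveKernel K) : Matrix.PosSemidef (Matrix.of K) := by
  have h := (RKHS.posSemidef_tfae (K := Matrix.of K)).out 0 2
  refine h.mpr ⟨?_, fun c => ?_⟩
  · ext1 x y
    exact hK.adjoint_eq y x
  · have h := (Complex.le_def.1 (hK.finsupp_sum_nonneg c)).1
    refine h.trans_eq ?_
    rw [← Complex.conj_re]
    change _ = Complex.re _
    congr 1
    simp only [Finsupp.sum, map_sum, inner_conj_symm]
    rw [Finset.sum_comm]
    rfl

/-- Kolmogorov factorization of a positive kernel. -/
theorem exists_factorization {Ω : Type u} {F : Type v} [NormedAddCommGroup F]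
    [InnerProductSpace ℂ F] [CompleteSpace F] {K : Ω → Ω → (F →L[ℂ] F)}
    (hK : IsPositiveKernel K) :
    ∃ (H : Type (max u v)) (_ : NormedAddCommGroup H) (_ : InnerProductSpace ℂ H) (_ : CompleteSpace H)
      (κ : Ω → F →L[ℂ] H), ∀ z w, K z w = (κ z).adjoint ∘L κ w := by
  have : Fact (Matrix.PosSemidef (Matrix.of K)) := ⟨hK.posSemidef⟩
  refine ⟨RKHS.OfKernel (Matrix.of K), inferInstance, inferInstance, inferInstance,
    RKHS.kerFun (RKHS.OfKernel (Matrix.of K)), fun z w => ?_⟩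
  rw [← RKHS.kernel_apply, RKHS.OfKernel.kernel_ofKernel]
  rfl

end IsPositiveKernel

/-- If the kernel `κ_z* κ_w` is dominated by `l_z* l_w`, then `κ = T l` for a contraction `T`. -/
theorem exists_contraction_of_isPositiveKernel_sub {H' : Type*} [NormedAddCommGroup H']
    [InnerProductSpace ℂ H'] [CompleteSpace H'] {κ : Ω → F →L[ℂ] H} {l : Ω → F →L[ℂ] H'}
    (h : IsPositiveKernel fun z w => (l z).adjoint ∘L l w - (κ z).adjoint ∘L κ w) :
    ∃ T : H' →L[ℂ] H, ‖T‖ ≤ 1 ∧ ∀ w η, T (l w η) = κ w η := by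
  have hlsum : ∀ (c : Ω →₀ F), ‖Finsupp.lsum ℂ (fun w => (κ w : F →ₗ[ℂ] H)) c‖
      ≤ ‖Finsupp.lsum ℂ (fun w => (l w : F →ₗ[ℂ] H')) c‖ := fun c => by
    have h1 := h.finsupp_sum_nonneg c
    have h2 := sum_inner_adjoint_comp κ c.support id c
    have h3 := sum_inner_adjoint_comp l c.support id c
    simp only [Finsupp.sum, sub_apply, inner_sub_right, Finset.sum_sub_distrib] at h1
    rw [sub_nonneg] at h1
    have h4 := (h2.symm.le.trans h1).trans h3.le
    exact (pow_le_pow_iff_left₀ (norm_nonneg _) (norm_nonneg _) two_ne_zero).1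
      (Complex.real_le_real.1 h4)
  obtain ⟨T, hT, hT2⟩ := exists_contraction_comp_eq _ _ hlsum
  refine ⟨T, hT, fun w η => ?_⟩
  simpa using hT2 (Finsupp.single w η)

/-- Division of a positive kernel on the bidisk by `1 - z_j w̄_j`, a geometric series. -/
theorem IsPositiveKernel.inv_smul {K : bidisk → bidisk → (F →L[ℂ] F)} (hK : IsPositiveKernel K)
    (j : Fin 2) :
    IsPositiveKernel fun z w => (1 - z.1 j * (starRingEnd ℂ) (w.1 j))⁻¹ • K z w := fun N x η => by
  have hs : HasSum (fun k : ℕ => ∑ i, ∑ l, inner ℂ ((starRingEnd ℂ) ((x i).1 j) ^ k • η i)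
      (K (x i) (x l) ((starRingEnd ℂ) ((x l).1 j) ^ k • η l)))
      (∑ i, ∑ l, inner ℂ (η i)
        (((1 - (x i).1 j * (starRingEnd ℂ) ((x l).1 j))⁻¹ • K (x i) (x l)) (η l))) := by
    refine hasSum_sum fun i _ => hasSum_sum fun l _ => ?_
    have hg := (hasSum_geometric_of_norm_lt_one
      (ξ := (x i).1 j * (starRingEnd ℂ) ((x l).1 j)) (by
        rw [norm_mul, RCLike.norm_conj]
        exact mul_lt_one_of_nonneg_of_lt_one_left (norm_nonneg _) ((x i).2 j)
          ((x l).2 j).le)).mul_right (inner ℂ (η i) (K (x i) (x l) (η l)))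
    rw [smul_apply, inner_smul_right]
    refine (congrArg (HasSum · _) (funext fun k => ?_)).mp hg
    rw [map_smul, inner_smul_left, inner_smul_right, map_pow, conj_conj, mul_pow, mul_assoc]
  exact hs.nonneg fun k => hK N x _

end PositiveKernels

/-! ### Geometry of the scattering space -/

namespace OpRange

variable {X : Type*} [NormedAddCommGroup X] [InnerProductSpace ℂ X] [CompleteSpace X]
  {Y : Type*} [AddCommGroup Y] [Module ℂ Y] [TopologicalSpace Y] [T1Space Y]

theorem inner_mk_left (R : X →L[ℂ] Y) (x : X) (u : OpRange R) :
    inner ℂ (mk R x) u = inner ℂ x (lift R u) := by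
  change inner ℂ (isometryEquiv R (mk R x)) (isometryEquiv R u) = _
  have h : isometryEquiv R (mk R x) = (LinearMap.ker R.toLinearMap)ᗮ.orthogonalProjectionOnto x :=
    (isometryEquiv R).apply_symm_apply _
  rw [h, Submodule.coe_inner, ← Submodule.starProjection_apply,
    Submodule.inner_starProjection_left_eq_right]
  congr 1
  exact Submodule.starProjection_eq_self_iff.2 (isometryEquiv R u).2

theorem adjoint_lift (R : X →L[ℂ] Y) : (lift R).adjoint = mk R :=
  ContinuousLinearMap.ext fun x => ext_inner_right ℂ fun u => by
    rw [ContinuousLinearMap.adjoint_inner_left, inner_mk_left]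

end OpRange

theorem adjoint_sqrtOp {H : Type*} [NormedAddCommGroup H] [InnerProductSpace ℂ H]
    [CompleteSpace H] (T : H →L[ℂ] H) : (sqrtOp T).adjoint = sqrtOp T :=
  ((ContinuousLinearMap.nonneg_iff_isPositive _).1 (CFC.sqrt_nonneg T)).isSelfAdjoint.adjoint_eq

variable {E F : Type*} [NormedAddCommGroup E] [InnerProductSpace ℂ E] [CompleteSpace E]
  [NormedAddCommGroup F] [InnerProductSpace ℂ F] [CompleteSpace F]

namespace SchurClass
variable (Φ : SchurClass E F)

/-- `block` is the adjoint of the inclusion `pair`. -/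
theorem inner_block (x : PairL2 E F) (u : Φ.ScatteringSpace) :
    inner ℂ (Φ.block x) u = inner ℂ x (Φ.pair u) := by
  change inner ℂ (OpRange.mk _ (Φ.sqrtBlockOp x)) u = inner ℂ x (Φ.sqrtBlockOp (OpRange.lift _ u))
  rw [OpRange.inner_mk_left, ← ContinuousLinearMap.adjoint_inner_right]
  exact congrArg (fun A : PairL2 E F →L[ℂ] PairL2 E F => inner ℂ x (A _)) (adjoint_sqrtOp _)

theorem pair_injective : Function.Injective Φ.pair := OpRange.incl_injective _

theorem inner_outCol (g : L2 E) (u : Φ.ScatteringSpace) :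
    inner ℂ (Φ.outCol g) u = inner ℂ g (Φ.pair u).snd := by
  refine (Φ.inner_block _ u).trans ?_
  simp [WithLp.prod_inner_apply]

theorem inner_inCol (f : L2 F) (u : Φ.ScatteringSpace) :
    inner ℂ (Φ.inCol f) u = inner ℂ f (Φ.pair u).fst := by
  refine (Φ.inner_block _ u).trans ?_
  simp [WithLp.prod_inner_apply]

theorem eq_of_inner_block {u v : Φ.ScatteringSpace}
    (h : ∀ x, inner ℂ (Φ.block x) u = inner ℂ (Φ.block x) v) : u = v :=
  Φ.pair_injective (ext_inner_left ℂ fun x => by rw [← inner_block, ← inner_block, h])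

theorem fst_mulZ (j : Fin 2) (u : Φ.ScatteringSpace) :
    (Φ.pair (Φ.mulZ j u)).fst = shift j (Φ.pair u).fst := by
  rw [pair_mulZ]; rfl

theorem snd_mulZ (j : Fin 2) (u : Φ.ScatteringSpace) :
    (Φ.pair (Φ.mulZ j u)).snd = shift j (Φ.pair u).snd := by
  rw [pair_mulZ]; rfl

theorem mulZ_outCol (j : Fin 2) (g : L2 E) : Φ.mulZ j (Φ.outCol g) = Φ.outCol (shift j g) :=
  Φ.pair_injective (by rw [pair_mulZ, pair_outCol, pair_outCol, mulOp_shift]; rfl)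

theorem mulZ_inCol (j : Fin 2) (f : L2 F) : Φ.mulZ j (Φ.inCol f) = Φ.inCol (shift j f) :=
  Φ.pair_injective (by rw [pair_mulZ, pair_inCol, pair_inCol, adjoint_mulOp_shift]; rfl)

theorem mulZ_block (j : Fin 2) (x : PairL2 E F) :
    Φ.mulZ j (Φ.block x) = Φ.block (WithLp.toLp 2 (shift j x.fst, shift j x.snd)) :=
  Φ.pair_injective (by
    rw [pair_mulZ, pair_block, pair_block, blockOp_apply, blockOp_apply]
    simp [mulOp_shift, adjoint_mulOp_shift])

/-- Multiplication by `Z_j` is isometric on the scattering space. -/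
theorem adjoint_mulZ_mulZ (j : Fin 2) (u : Φ.ScatteringSpace) :
    (Φ.mulZ j).adjoint (Φ.mulZ j u) = u :=
  Φ.eq_of_inner_block fun x => by
    rw [ContinuousLinearMap.adjoint_inner_right, mulZ_block, inner_block, inner_block,
      pair_mulZ]
    simp [WithLp.prod_inner_apply]

theorem norm_mulZ_apply (j : Fin 2) (u : Φ.ScatteringSpace) : ‖Φ.mulZ j u‖ = ‖u‖ := by
  rw [← sq_eq_sq₀ (norm_nonneg _) (norm_nonneg _), ← inner_self_eq_norm_sq (𝕜 := ℂ),
    ← inner_self_eq_norm_sq (𝕜 := ℂ), ← ContinuousLinearMap.adjoint_inner_right,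
    adjoint_mulZ_mulZ]

theorem pow_mulZ_succ_apply (j : Fin 2) (k : ℕ) (u : Φ.ScatteringSpace) :
    (Φ.mulZ j ^ (k + 1)) u = Φ.mulZ j ((Φ.mulZ j ^ k) u) := by
  rw [pow_succ']; rfl

theorem fst_pow_mulZ (j : Fin 2) (k : ℕ) (u : Φ.ScatteringSpace) :
    (Φ.pair ((Φ.mulZ j ^ k) u)).fst = (shift j)^[k] (Φ.pair u).fst := by
  induction k with
  | zero => rfl
  | succ k ih => rw [pow_mulZ_succ_apply, fst_mulZ, ih, Function.iterate_succ_apply']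

theorem snd_pow_mulZ (j : Fin 2) (k : ℕ) (u : Φ.ScatteringSpace) :
    (Φ.pair ((Φ.mulZ j ^ k) u)).snd = (shift j)^[k] (Φ.pair u).snd := by
  induction k with
  | zero => rfl
  | succ k ih => rw [pow_mulZ_succ_apply, snd_mulZ, ih, Function.iterate_succ_apply']

theorem norm_pow_mulZ_apply (j : Fin 2) (k : ℕ) (u : Φ.ScatteringSpace) :
    ‖(Φ.mulZ j ^ k) u‖ = ‖u‖ := by
  induction k with
  | zero => rfl
  | succ k ih => rw [pow_mulZ_succ_apply, norm_mulZ_apply, ih]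

theorem pow_mulZ_inCol (j : Fin 2) (k : ℕ) (f : L2 F) :
    (Φ.mulZ j ^ k) (Φ.inCol f) = Φ.inCol ((shift j)^[k] f) := by
  induction k with
  | zero => rfl
  | succ k ih => rw [pow_mulZ_succ_apply, ih, mulZ_inCol, Function.iterate_succ_apply']

theorem pow_mulZ_outCol (j : Fin 2) (k : ℕ) (g : L2 E) :
    (Φ.mulZ j ^ k) (Φ.outCol g) = Φ.outCol ((shift j)^[k] g) := by
  induction k with
  | zero => rfl
  | succ k ih => rw [pow_mulZ_succ_apply, ih, mulZ_outCol, Function.iterate_succ_apply']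

/-- `𝒦_Φ` consists of the pairs `[f; g]` with `f ∈ H²` and `g ⊥ H²`. -/
theorem mem_scatteringSubspace {u : Φ.ScatteringSpace} :
    u ∈ Φ.scatteringSubspace ↔ (Φ.pair u).fst ∈ H2 F ∧ (Φ.pair u).snd ∈ (H2 E)ᗮ := by
  rw [scatteringSubspace, ← Submodule.inf_orthogonal, Submodule.mem_inf]
  refine and_congr ?_ ?_
  · rw [H2, mem_suppIn_iff_inner, ← suppIn_orthogonal, Submodule.mem_orthogonal]
    refine ⟨fun h f hf => ?_, ?_⟩
    · rw [← inner_inCol]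
      exact h _ ⟨f, hf, rfl⟩
    · rintro h _ ⟨f, hf, rfl⟩
      rw [inner_inCol]
      exact h f hf
  · rw [Submodule.mem_orthogonal, Submodule.mem_orthogonal]
    refine ⟨fun h f hf => ?_, ?_⟩
    · rw [← inner_outCol]
      exact h _ ⟨f, hf, rfl⟩
    · rintro h _ ⟨f, hf, rfl⟩
      rw [inner_outCol]
      exact h f hf

theorem outCol_mem_orthogonal {g : L2 E} (hg : g ∈ H2 E) :
    Φ.outCol g ∈ Φ.scatteringSubspaceᗮ :=
  Submodule.le_orthogonal_orthogonal _ (Submodule.mem_sup_right ⟨g, hg, rfl⟩)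

theorem inCol_mem_orthogonal {f : L2 F} (hf : f ∈ (H2 F)ᗮ) :
    Φ.inCol f ∈ Φ.scatteringSubspaceᗮ :=
  Submodule.le_orthogonal_orthogonal _ (Submodule.mem_sup_left ⟨f, hf, rfl⟩)

/-- `S_j^max` consists of the pairs `[f; g] ∈ 𝒦_Φ` for which `g` has only negative frequencies in
the other variable. -/
theorem mem_Smax {i j : Fin 2} (hij : i ≠ j) {u : Φ.ScatteringSpace} :
    u ∈ Φ.Smax j ↔ u ∈ Φ.scatteringSubspace ∧ (Φ.pair u).snd ∈ suppIn {n | n i < 0} := by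
  have hall : ∀ {p : Fin 2 → Prop}, (∀ l, p l) ↔ p i ∧ p j := fun {p} =>
    ⟨fun h => ⟨h i, h j⟩, fun h l => by
      rcases eq_or_eq_of_ne hij l with rfl | rfl
      exacts [h.1, h.2]⟩
  simp only [Smax, Submodule.mem_iInf, Submodule.mem_comap, ContinuousLinearMap.coe_coe]
  refine ⟨fun h => ⟨h 0, fun n hn => ?_⟩, fun h k => ?_⟩
  · -- `ĝ(n)` is a coefficient of `Z_j^k g` with nonnegative index as soon as `n_j + k ≥ 0`
    have h1 := (Φ.mem_scatteringSubspace.1 (h (n j).natAbs)).2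
    rw [snd_pow_mulZ, H2_orthogonal] at h1
    have h2 := h1 (n + Pi.single j ((n j).natAbs : ℤ)) (by
      rw [mem_compl_iff, not_not, mem_ofPred_eq, hall]
      simp only [mem_ofPred_eq, not_lt] at hn
      have := neg_abs_le (n j)
      simp [hij, hn]
      omega)
    rwa [iterate_shift_apply, add_sub_cancel_right] at h2
  · rw [mem_scatteringSubspace, fst_pow_mulZ, snd_pow_mulZ]
    have hf := (Φ.mem_scatteringSubspace.1 h.1).1
    constructor
    · clear h
      induction k with
      | zero => exact hf
      | succ k ih => rw [Function.iterate_succ_apply']; exact shift_mem_H2 j ih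
    · rw [H2_orthogonal]
      intro n hn
      rw [mem_compl_iff, not_not] at hn
      rw [iterate_shift_apply]
      refine h.2 _ ?_
      simp [hij, hn i]

theorem Smax_le (j : Fin 2) : Φ.Smax j ≤ Φ.scatteringSubspace := fun u hu => by
  have := Submodule.mem_iInf _ |>.1 hu 0
  simpa using this

theorem mulZ_mem_Smax (j : Fin 2) {u : Φ.ScatteringSpace} (hu : u ∈ Φ.Smax j) :
    Φ.mulZ j u ∈ Φ.Smax j := by
  simp only [Smax, Submodule.mem_iInf, Submodule.mem_comap, ContinuousLinearMap.coe_coe] at hu ⊢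
  intro k
  have := hu (k + 1)
  rwa [pow_succ] at this

instance (j : Fin 2) : CompleteSpace (Φ.Smax j) := (Φ.isClosed_Smax j).completeSpace_coe

instance (j : Fin 2) : CompleteSpace (Φ.Smin j) := (Φ.isClosed_Smin j).completeSpace_coe

theorem Smin_le (j : Fin 2) : Φ.Smin j ≤ Φ.scatteringSubspace := by
  refine Submodule.topologicalClosure_minimal _ ?_ Φ.isClosed_scatteringSubspace
  rintro _ ⟨_, _, rfl⟩
  exact Submodule.starProjection_apply_mem _ _

/-- `S_j^max` and `S_i^min` are complementary in `𝒦_Φ` when `i ≠ j`. -/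
theorem Smax_eq {i j : Fin 2} (hij : i ≠ j) :
    Φ.Smax j = Φ.scatteringSubspace ⊓ (Φ.Smin i)ᗮ := by
  ext u
  rw [Φ.mem_Smax hij, Submodule.mem_inf]
  refine and_congr_right fun hu => ?_
  have hort : u ∈ (Φ.Smin i)ᗮ ↔ (Φ.pair u).snd ∈ (L2plusMinus E i)ᗮ := by
    rw [Smin, Submodule.orthogonal_closure, Submodule.mem_orthogonal, Submodule.mem_orthogonal]
    have key : ∀ h, inner ℂ (Φ.scatteringSubspace.starProjection (Φ.outCol h)) u
        = inner ℂ h (Φ.pair u).snd := fun h => by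
      rw [Submodule.inner_starProjection_left_eq_right,
        Submodule.starProjection_eq_self_iff.2 hu, inner_outCol]
    refine ⟨fun h f hf => ?_, ?_⟩
    · rw [← key]
      exact h _ ⟨_, ⟨f, hf, rfl⟩, rfl⟩
    · rintro h _ ⟨_, ⟨f, hf, rfl⟩, rfl⟩
      exact (key f).trans (h f hf)
  rw [hort, L2plusMinus, suppIn_orthogonal]
  have hg := (Φ.mem_scatteringSubspace.1 hu).2
  rw [H2_orthogonal] at hg
  refine ⟨fun h => suppIn_mono (N := {n | n i < 0})
    (by intro n hn hn'; exact absurd hn'.1 (not_le.2 hn)) h, fun h n hn => ?_⟩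
  simp only [mem_ofPred_eq, not_lt] at hn
  by_cases hj : 0 ≤ n j
  · refine hg n (not_not.2 fun l => ?_)
    rcases eq_or_eq_of_ne hij l with rfl | rfl <;> assumption
  · refine h n (not_not.2 ⟨hn, fun l hl => ?_⟩)
    rcases eq_or_eq_of_ne hij l with rfl | rfl
    exacts [absurd rfl hl, not_le.1 hj]

/-- The generators of `S_j^min`: for `h ∈ L²_{+-}` (or `L²_{-+}` if `j = 1`), the projection of
`[Φ; I] h` is `[Φ; I] h - [I; Φ*] p`, where `p` is the projection of `Φ h` to `L² ⊖ H²`. Its second component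
`h - Φ* p` has only negative frequencies in the other variable, so it lies in `S_j^max`. -/
theorem exists_projection_outCol {i j : Fin 2} (hij : i ≠ j) {h : L2 E}
    (hh : h ∈ L2plusMinus E j) :
    ∃ p ∈ (suppIn {n | n i < 0} : Submodule ℂ (L2 F)),
      Φ.scatteringSubspace.starProjection (Φ.outCol h) = Φ.outCol h - Φ.inCol p ∧
      Φ.outCol h - Φ.inCol p ∈ Φ.Smax j := by
  have hsub : ∀ {n : Fin 2 → ℤ}, n i < 0 → n ∈ {n : Fin 2 → ℤ | ∀ l, 0 ≤ n l}ᶜ :=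
    fun hn hn' => absurd (hn' i) (not_le.2 hn)
  have hlow : IsLowerSet {n : Fin 2 → ℤ | n i < 0} := fun a b hab ha => (hab i).trans_lt ha
  have hup : IsUpperSet {n : Fin 2 → ℤ | 0 ≤ n j} := fun a b hab ha => le_trans ha (hab j)
  have hΦh : Φ.mulOp h ∈ suppIn {n | 0 ≤ n j} :=
    Φ.mulOp_mem_suppIn hup (suppIn_mono (fun n hn => hn.1) hh)
  have hP := Submodule.starProjection_apply_mem (H2 F) (Φ.mulOp h)
  have hp1 := Submodule.sub_starProjection_mem_orthogonal (K := H2 F) (Φ.mulOp h)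
  set p := Φ.mulOp h - (H2 F).starProjection (Φ.mulOp h) with hp
  have hpi : p ∈ suppIn {n | n i < 0} := fun n hn => by
    simp only [mem_ofPred_eq, not_lt] at hn
    by_cases hj : 0 ≤ n j
    · rw [H2_orthogonal] at hp1
      refine hp1 n (not_not.2 fun l => ?_)
      rcases eq_or_eq_of_ne hij l with rfl | rfl <;> assumption
    · change Φ.mulOp h n - (H2 F).starProjection (Φ.mulOp h) n = 0
      rw [hΦh n hj, hP n fun h' => hj (h' j), sub_zero]
  have hpair : Φ.pair (Φ.outCol h - Φ.inCol p)
      = WithLp.toLp 2 ((H2 F).starProjection (Φ.mulOp h), h - Φ.mulOp.adjoint p) := by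
    rw [map_sub, pair_outCol, pair_inCol, ← WithLp.toLp_sub, Prod.mk_sub_mk, hp, sub_sub_cancel]
  have hsnd : h - Φ.mulOp.adjoint p ∈ suppIn {n | n i < 0} :=
    sub_mem (suppIn_mono (fun n hn => hn.2 i hij) hh) (Φ.adjoint_mulOp_mem_suppIn hlow hpi)
  have hK : Φ.outCol h - Φ.inCol p ∈ Φ.scatteringSubspace := by
    rw [mem_scatteringSubspace, hpair]
    refine ⟨hP, ?_⟩
    rw [H2_orthogonal]
    exact suppIn_mono (fun n hn => hsub hn) hsnd
  refine ⟨p, hpi, ?_, (Φ.mem_Smax hij).2 ⟨hK, by rw [hpair]; exact hsnd⟩⟩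
  refine Submodule.eq_starProjection_of_mem_orthogonal hK ?_
  rw [sub_sub_cancel]
  exact Φ.inCol_mem_orthogonal hp1

/-- Equivalently, `S_1^min` and `S_2^min` are orthogonal. -/
theorem Smin_le_Smax (j : Fin 2) : Φ.Smin j ≤ Φ.Smax j := by
  refine Submodule.topologicalClosure_minimal _ ?_ (Φ.isClosed_Smax j)
  rintro _ ⟨_, ⟨h, hh, rfl⟩, rfl⟩
  obtain ⟨p, -, h1, h2⟩ := Φ.exists_projection_outCol (i := j + 1) (by omega) hh
  rw [ContinuousLinearMap.coe_coe, h1]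
  exact h2

theorem mulZ_mem_Smin (j : Fin 2) {u : Φ.ScatteringSpace} (hu : u ∈ Φ.Smin j) :
    Φ.mulZ j u ∈ Φ.Smin j := by
  have hij : j + 1 ≠ j := by omega
  refine map_mem_closure (Φ.mulZ j).continuous hu ?_
  rintro _ ⟨_, ⟨h, hh, rfl⟩, rfl⟩
  obtain ⟨p, hp, h1, h2⟩ := Φ.exists_projection_outCol hij hh
  refine ⟨_, ⟨shift j h, ?_, rfl⟩, ?_⟩
  · intro n hn
    rw [shift_apply]
    refine hh _ fun hn' => hn ⟨?_, fun l hl => ?_⟩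
    · have := hn'.1
      simp at this
      omega
    · have := hn'.2 l hl
      simpa [hl] using this
  · -- `Z_j` commutes with the formula for the projection
    rw [ContinuousLinearMap.coe_coe, h1, map_sub, mulZ_outCol, mulZ_inCol]
    refine Submodule.eq_starProjection_of_mem_orthogonal ?_ ?_
    · rw [← mulZ_outCol, ← mulZ_inCol, ← map_sub]
      exact Φ.Smax_le j (Φ.mulZ_mem_Smax j h2)
    · rw [sub_sub_cancel]
      refine Φ.inCol_mem_orthogonal ?_
      rw [H2_orthogonal]
      have hs : shift j p ∈ suppIn {n | n (j + 1) < 0} :=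
        (shift_mem_suppIn_iff fun n => by simp [hij]).2 hp
      exact suppIn_mono (N := {n | n (j + 1) < 0})
        (by intro n hn hn'; exact absurd (hn' (j + 1)) (not_le.2 hn)) hs

end SchurClass

/-! ### Kernels of subspaces of the scattering space -/

/-- The reproducing kernel of the operator range of `R` is `(z, w) ↦ R_z R_w*`. -/
theorem OpRange.kernel_apply {X Ω F : Type*} [NormedAddCommGroup X] [InnerProductSpace ℂ X]
    [CompleteSpace X] [NormedAddCommGroup F] [InnerProductSpace ℂ F] [CompleteSpace F]
    (R : X →L[ℂ] (Ω → F)) (z w : Ω) (η : F) :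
    RKHS.kernel (OpRange R) z w η = R ((ContinuousLinearMap.proj (R := ℂ) w ∘L R).adjoint η) z := by
  have hev : (ContinuousLinearMap.proj (R := ℂ) w ∘L RKHS.coeCLM (H := OpRange R) ℂ)
      = (ContinuousLinearMap.proj (R := ℂ) w ∘L R) ∘L OpRange.lift R := rfl
  rw [← RKHS.kerFun_apply, RKHS.kerFun, hev, ContinuousLinearMap.adjoint_comp,
    OpRange.adjoint_lift]
  exact congrFun (OpRange.incl_mk R _) z

theorem one_sub_mul_conj_ne_zero (z w : bidisk) (i : Fin 2) :
    (1 - z.1 i * (starRingEnd ℂ) (w.1 i)) ≠ 0 := fun h => by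
  have h1 : ‖z.1 i * (starRingEnd ℂ) (w.1 i)‖ < 1 := by
    rw [norm_mul, RCLike.norm_conj]
    exact mul_lt_one_of_nonneg_of_lt_one_left (norm_nonneg _) (z.2 i) (w.2 i).le
  rw [← sub_eq_zero.1 h, norm_one] at h1
  exact lt_irrefl _ h1

namespace SchurClass
variable (Φ : SchurClass E F)

/-- The evaluation `[f; g] ↦ f(w)` on the scattering space. -/
def pointEval (w : bidisk) : Φ.ScatteringSpace →L[ℂ] F :=
  evalAt F w ∘L WithLp.fstL 2 ℂ (L2 F) (L2 E) ∘L Φ.pair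

theorem pointEval_apply (w : bidisk) (u : Φ.ScatteringSpace) :
    Φ.pointEval w u = evalAt F w (Φ.pair u).fst := rfl

theorem kernelOf_apply (S : Submodule ℂ Φ.ScatteringSpace) [CompleteSpace S] (z w : bidisk)
    (η : F) :
    Φ.kernelOf S z w η = Φ.pointEval z (S.starProjection ((Φ.pointEval w).adjoint η)) := by
  have hev : ContinuousLinearMap.proj (R := ℂ) w ∘L (Φ.firstComponent ∘L S.subtypeL)
      = Φ.pointEval w ∘L S.subtypeL := rfl
  rw [kernelOf, OpRange.kernel_apply, hev, ContinuousLinearMap.adjoint_comp, Submodule.adjoint_subtypeL,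
    Submodule.starProjection_apply]
  rfl

/-- The kernel of `S` in factorized form. -/
theorem kernelOf_eq (S : Submodule ℂ Φ.ScatteringSpace) [CompleteSpace S] (z w : bidisk) :
    Φ.kernelOf S z w = (S.starProjection ∘L (Φ.pointEval z).adjoint).adjoint
      ∘L (S.starProjection ∘L (Φ.pointEval w).adjoint) := by
  refine ContinuousLinearMap.ext fun η => ext_inner_left ℂ fun ξ => ?_
  rw [kernelOf_apply, ContinuousLinearMap.comp_apply, ContinuousLinearMap.adjoint_inner_right,
    ContinuousLinearMap.comp_apply, ContinuousLinearMap.comp_apply,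
    Submodule.inner_starProjection_left_eq_right,
    Submodule.starProjection_eq_self_iff.2 (Submodule.starProjection_apply_mem _ _),
    ContinuousLinearMap.adjoint_inner_left]

theorem kernelOf_inf_orthogonal {S K : Submodule ℂ Φ.ScatteringSpace} (h : S ≤ K)
    [CompleteSpace S] [CompleteSpace K] {R : Submodule ℂ Φ.ScatteringSpace} [CompleteSpace R]
    (hR : R = K ⊓ Sᗮ) (z w : bidisk) :
    Φ.kernelOf R z w = Φ.kernelOf K z w - Φ.kernelOf S z w := by
  subst hR
  ext1 η
  rw [sub_apply, kernelOf_apply, kernelOf_apply, kernelOf_apply, starProjection_inf_orthogonal h,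
    map_sub]

theorem pointEval_mulZ (w : bidisk) (j : Fin 2) {u : Φ.ScatteringSpace}
    (hu : u ∈ Φ.scatteringSubspace) :
    Φ.pointEval w (Φ.mulZ j u) = w.1 j • Φ.pointEval w u := by
  rw [pointEval_apply, fst_mulZ, evalAt_shift _ _ (Φ.mem_scatteringSubspace.1 hu).1]
  rfl

/-- Passing from an invariant subspace `S` to `S ⊖ Z_j S` multiplies the kernel by
`1 - z_j w̄_j`. -/
theorem kernelOf_wandering (j : Fin 2) {S : Submodule ℂ Φ.ScatteringSpace} [CompleteSpace S]
    [CompleteSpace (Φ.wandering j S)] (hSK : S ≤ Φ.scatteringSubspace)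
    (hS : ∀ u ∈ S, Φ.mulZ j u ∈ S) (z w : bidisk) :
    Φ.kernelOf (Φ.wandering j S) z w
      = (1 - z.1 j * (starRingEnd ℂ) (w.1 j)) • Φ.kernelOf S z w := by
  ext1 η
  have hadj : S.starProjection ((Φ.mulZ j).adjoint ((Φ.pointEval w).adjoint η))
      = (starRingEnd ℂ) (w.1 j) • S.starProjection ((Φ.pointEval w).adjoint η) := by
    refine ext_inner_left ℂ fun u => ?_
    rw [inner_smul_right, ← Submodule.inner_starProjection_left_eq_right,
      ← Submodule.inner_starProjection_left_eq_right, ContinuousLinearMap.adjoint_inner_right,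
      ContinuousLinearMap.adjoint_inner_right, ContinuousLinearMap.adjoint_inner_right,
      pointEval_mulZ _ _ _ (hSK (Submodule.starProjection_apply_mem _ _)), inner_smul_left]
  have hinst : (S ⊓ (S.map (Φ.mulZ j : _ →ₗ[ℂ] Φ.ScatteringSpace))ᗮ).HasOrthogonalProjection :=
    inferInstanceAs (Φ.wandering j S).HasOrthogonalProjection
  have hP : (Φ.wandering j S).starProjection ((Φ.pointEval w).adjoint η) = _ :=
    starProjection_wandering (Φ.adjoint_mulZ_mulZ j) hS _
  rw [kernelOf_apply, hP, hadj, map_sub, map_smul, map_smul,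
    pointEval_mulZ _ _ _ (hSK (Submodule.starProjection_apply_mem _ _)), smul_apply,
    kernelOf_apply, sub_smul, one_smul, smul_smul, mul_comm]

theorem adjoint_pointEval_apply (w : bidisk) (η : F) :
    (Φ.pointEval w).adjoint η = Φ.inCol ((evalAt F w).adjoint η) :=
  ext_inner_right ℂ fun u => by
    rw [ContinuousLinearMap.adjoint_inner_left, inner_inCol,
      ContinuousLinearMap.adjoint_inner_left]
    rfl

/-- The kernel of `𝒦_Φ` is the de Branges–Rovnyak kernel of `Φ`. -/
theorem kernelOf_scatteringSubspace (z w : bidisk) :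
    ContinuousLinearMap.id ℂ F - Φ.toFun z ∘L (Φ.toFun w).adjoint
      = (∏ i, (1 - z.1 i * (starRingEnd ℂ) (w.1 i))) •
        Φ.kernelOf Φ.scatteringSubspace z w := by
  ext1 η
  set f := (evalAt F w).adjoint η
  set g := (evalAt E w).adjoint ((Φ.toFun w).adjoint η)
  have hf : f ∈ H2 F := adjoint_evalAt_mem_H2 w _
  have hg : g ∈ H2 E := adjoint_evalAt_mem_H2 w _
  have hpair : Φ.pair (Φ.inCol f - Φ.outCol g)
      = WithLp.toLp 2 (f - Φ.mulOp g, Φ.mulOp.adjoint f - g) := by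
    rw [map_sub, pair_outCol, pair_inCol, ← WithLp.toLp_sub, Prod.mk_sub_mk]
  -- `g` is the projection of `Φ* f` to `H²`
  have hP : Φ.scatteringSubspace.starProjection (Φ.inCol f) = Φ.inCol f - Φ.outCol g := by
    refine Submodule.eq_starProjection_of_mem_orthogonal ?_ ?_
    · rw [mem_scatteringSubspace, hpair]
      refine ⟨sub_mem hf (Φ.mulOp_mem_suppIn isUpperSet_nonneg hg), ?_⟩
      rw [Submodule.mem_orthogonal]
      intro h hh
      change inner ℂ h (Φ.mulOp.adjoint f - g) = 0
      rw [inner_sub_right, ContinuousLinearMap.adjoint_inner_right,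
        ContinuousLinearMap.adjoint_inner_right, ContinuousLinearMap.adjoint_inner_right,
        ContinuousLinearMap.adjoint_inner_right, evalAt_mulOp Φ w hh, sub_self]
    · rw [sub_sub_cancel]
      exact Φ.outCol_mem_orthogonal hg
  rw [smul_apply, kernelOf_apply, adjoint_pointEval_apply, hP, pointEval_apply, hpair]
  change _ = _ • evalAt F z (f - Φ.mulOp g)
  rw [map_sub, evalAt_mulOp Φ z hg, evalAt_adjoint_evalAt, evalAt_adjoint_evalAt, map_smul,
    ← smul_sub, smul_smul, ← Finset.prod_mul_distrib]
  rw [Finset.prod_congr rfl fun i _ => mul_inv_cancel₀ (one_sub_mul_conj_ne_zero z w i), Finset.prod_const_one, one_smul]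
  rfl

end SchurClass

/-! ### Maximality of `S_j^max` -/

section PositiveKernels

variable {Ω : Type*}

theorem IsPositiveKernel.add {K L : Ω → Ω → (F →L[ℂ] F)} (hK : IsPositiveKernel K)
    (hL : IsPositiveKernel L) : IsPositiveKernel fun z w => K z w + L z w := fun N x η => by
  simp only [add_apply, inner_add_right, Finset.sum_add_distrib]
  exact add_nonneg (hK N x η) (hL N x η)

theorem IsPositiveKernel.mul_conj_smul {K : Ω → Ω → (F →L[ℂ] F)} (hK : IsPositiveKernel K)
    (f : Ω → ℂ) :
    IsPositiveKernel fun z w => (f z * (starRingEnd ℂ) (f w)) • K z w := fun N x η => by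
  refine (hK N x fun i => (starRingEnd ℂ) (f (x i)) • η i).trans_eq ?_
  refine Finset.sum_congr rfl fun i _ => Finset.sum_congr rfl fun j _ => ?_
  rw [map_smul, inner_smul_left, inner_smul_right, smul_apply, inner_smul_right, conj_conj,
    mul_assoc]

end PositiveKernels

namespace SchurClass
variable (Φ : SchurClass E F)

/-- If all the functions `z_j^k f` come from elements `u_k` of `𝒦_Φ` of norm at most `C`, then `f`
comes from an element of `S_j^max` of norm at most `C`: a weak limit of `(Z_j*)^k u_k`. -/
theorem exists_mem_Smax {i j : Fin 2} (hij : i ≠ j) {f : bidisk → F} {C : ℝ}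
    (h : ∀ k : ℕ, ∃ u ∈ Φ.scatteringSubspace, ‖u‖ ≤ C ∧ ∀ z, Φ.pointEval z u = z.1 j ^ k • f z) :
    ∃ v ∈ Φ.Smax j, ‖v‖ ≤ C ∧ ∀ z, Φ.pointEval z v = f z := by
  choose u huK huC hu using h
  have huK' := fun k => Φ.mem_scatteringSubspace.1 (huK k)
  have hfst : ∀ k, (Φ.pair (u k)).fst = (shift j)^[k] (Φ.pair (u 0)).fst := fun k =>
    eq_of_evalAt_eq (huK' k).1 (iterate_shift_mem_H2 j k (huK' 0).1) fun w => by
      rw [evalAt_iterate_shift w j k (huK' 0).1, ← pointEval_apply, ← pointEval_apply, hu, hu,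
        pow_zero, one_smul]
  obtain ⟨v, hvC, hv⟩ := exists_inner_eq_of_eventually_eq
    (v := fun k => (Φ.mulZ j ^ k).adjoint (u k)) (C := C) fun k => by
      refine le_trans ?_ (huC k)
      have h1 : ‖(Φ.mulZ j ^ k).adjoint‖ ≤ 1 := by
        rw [LinearIsometryEquiv.norm_map]
        exact ContinuousLinearMap.opNorm_le_bound _ zero_le_one fun u => by
          rw [norm_pow_mulZ_apply, one_mul]
      simpa using (Φ.mulZ j ^ k).adjoint.le_of_opNorm_le h1 (u k)
  have hv1 : (Φ.pair v).fst = (Φ.pair (u 0)).fst := ext_inner_left ℂ fun p => by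
    rw [← inner_inCol]
    refine hv _ _ (Filter.Eventually.of_forall fun k => ?_)
    rw [ContinuousLinearMap.adjoint_inner_right, pow_mulZ_inCol, inner_inCol, hfst,
      inner_iterate_shift]
  have hv2 : (Φ.pair v).snd ∈ suppIn {n | n i < 0} := fun n hn => by
    simp only [mem_ofPred_eq, not_lt] at hn
    refine ext_inner_left ℂ fun x => ?_
    rw [← inner_single, ← inner_outCol, inner_zero_right]
    refine hv _ _ ?_
    filter_upwards [Filter.eventually_ge_atTop (n j).natAbs] with k hk
    rw [ContinuousLinearMap.adjoint_inner_right, pow_mulZ_outCol, inner_outCol,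
      iterate_shift_single]
    refine (huK' k).2 _ (single_mem_suppIn (fun l => ?_) x)
    rcases eq_or_eq_of_ne hij l with rfl | rfl
    · simpa [hij] using hn
    · simp
      omega
  refine ⟨v, (Φ.mem_Smax hij).2 ⟨Φ.mem_scatteringSubspace.2 ⟨?_, ?_⟩, hv2⟩, hvC, fun z => ?_⟩
  · rw [hv1]
    exact (huK' 0).1
  · rw [H2_orthogonal]
    exact suppIn_mono (N := {n | n i < 0})
      (by intro n hn hn'; exact absurd (hn' i) (not_le.2 hn)) hv2
  · rw [pointEval_apply, hv1, ← pointEval_apply, hu, pow_zero, one_smul]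

/-- The kernel of `S_j^max` dominates every positive kernel `A` which is dominated by the kernel of
`𝒦_Φ` and for which `(1 - z_j w̄_j) A` is positive. The latter condition makes multiplication by
`z_j` contractive on the space of `A`, so that for `f` in that space all the `z_j^k f` come from
elements of `𝒦_Φ` of norm at most `‖f‖`. -/
theorem isPositiveKernel_kernelOf_Smax_sub {i j : Fin 2} (hij : i ≠ j)
    {A : bidisk → bidisk → (F →L[ℂ] F)} (hA : IsPositiveKernel A)
    (hAj : IsPositiveKernel fun z w => (1 - z.1 j * (starRingEnd ℂ) (w.1 j)) • A z w)
    (hAK : IsPositiveKernel fun z w => Φ.kernelOf Φ.scatteringSubspace z w - A z w) :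
    IsPositiveKernel fun z w => Φ.kernelOf (Φ.Smax j) z w - A z w := by
  obtain ⟨H, _, _, _, a, ha⟩ := hA.exists_factorization
  have hk : ∀ k : ℕ, IsPositiveKernel fun z w => Φ.kernelOf Φ.scatteringSubspace z w
      - (z.1 j ^ k * (starRingEnd ℂ) (w.1 j ^ k)) • A z w := fun k => by
    induction k with
    | zero => simpa using hAK
    | succ k ih =>
      convert! ih.add (hAj.mul_conj_smul fun z => z.1 j ^ k) using 3 with z w
      simp only [smul_smul, map_pow]
      module
  have hlift : ∀ g : H, ∃ v ∈ Φ.Smax j, ‖v‖ ≤ ‖g‖ ∧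
      ∀ z, Φ.pointEval z v = (a z).adjoint g := fun g => by
    refine Φ.exists_mem_Smax hij fun k => ?_
    obtain ⟨T, hT, hTa⟩ := exists_contraction_of_isPositiveKernel_sub
      (κ := fun w => (starRingEnd ℂ) (w.1 j ^ k) • a w)
      (l := fun w => Φ.scatteringSubspace.starProjection ∘L (Φ.pointEval w).adjoint) (by
        convert! hk k using 3 with z w
        rw [kernelOf_eq, ha]
        ext1 η
        simp [map_smulₛₗ, smul_smul, mul_comm])
    refine ⟨Φ.scatteringSubspace.starProjection (T.adjoint g),
      Submodule.starProjection_apply_mem _ _, ?_, fun z => ext_inner_left ℂ fun ξ => ?_⟩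
    · refine (Submodule.norm_starProjection_apply_le _ _).trans ?_
      have : ‖T.adjoint‖ ≤ 1 := by rwa [LinearIsometryEquiv.norm_map]
      simpa using T.adjoint.le_of_opNorm_le this g
    · have h1 := hTa z ξ
      rw [← ContinuousLinearMap.adjoint_inner_left,
        ← Submodule.inner_starProjection_left_eq_right, ContinuousLinearMap.adjoint_inner_right]
      rw [ContinuousLinearMap.comp_apply] at h1
      rw [h1, smul_apply, inner_smul_left, conj_conj, inner_smul_right,
        ContinuousLinearMap.adjoint_inner_right]
  intro N x η
  set S := Φ.Smax j
  have h1 := sum_inner_adjoint_comp a Finset.univ x η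
  have h2 := sum_inner_adjoint_comp
    (fun w => S.starProjection ∘L (Φ.pointEval w).adjoint) Finset.univ x η
  simp only [sub_apply, inner_sub_right, Finset.sum_sub_distrib]
  simp only [kernelOf_eq, ha]
  rw [h1, h2, sub_nonneg, Complex.real_le_real]
  refine pow_le_pow_left₀ (norm_nonneg _) ?_ 2
  set g := ∑ i, a (x i) (η i)
  set q := ∑ i, (S.starProjection ∘L (Φ.pointEval (x i)).adjoint) (η i)
  obtain ⟨v, hvS, hvg, hv⟩ := hlift g
  -- `‖g‖² = ⟪q, v⟫ ≤ ‖q‖ ‖v‖ ≤ ‖q‖ ‖g‖`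
  have h3 : inner ℂ g g = inner ℂ q v := by
    rw [sum_inner, sum_inner]
    refine Finset.sum_congr rfl fun i _ => ?_
    rw [ContinuousLinearMap.comp_apply, Submodule.inner_starProjection_left_eq_right,
      Submodule.starProjection_eq_self_iff.2 hvS, ContinuousLinearMap.adjoint_inner_left, hv,
      ContinuousLinearMap.adjoint_inner_right]
  have h4 : ‖g‖ * ‖g‖ ≤ ‖q‖ * ‖g‖ := by
    rw [← inner_self_eq_norm_mul_norm (𝕜 := ℂ), h3]
    exact (re_inner_le_norm q v).trans (by gcongr)
  by_contra! hlt
  have hg : 0 < ‖g‖ := (norm_nonneg _).trans_lt hlt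
  exact absurd (le_of_mul_le_mul_right h4 hg) (not_le.2 hlt)

/-! ### Canonical Agler decompositions -/

theorem Kmax_eq (j : Fin 2) (z w : bidisk) : Φ.Kmax j z w
    = (1 - z.1 j * (starRingEnd ℂ) (w.1 j)) • Φ.kernelOf (Φ.Smax j) z w :=
  Φ.kernelOf_wandering j (Φ.Smax_le j) (fun _ hu => Φ.mulZ_mem_Smax j hu) z w

theorem Kmin_eq (j : Fin 2) (z w : bidisk) : Φ.Kmin j z w
    = (1 - z.1 j * (starRingEnd ℂ) (w.1 j)) • Φ.kernelOf (Φ.Smin j) z w :=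
  Φ.kernelOf_wandering j (Φ.Smin_le j) (fun _ hu => Φ.mulZ_mem_Smin j hu) z w

theorem kernelOf_Smax {i j : Fin 2} (hij : i ≠ j) (z w : bidisk) :
    Φ.kernelOf (Φ.Smax j) z w
      = Φ.kernelOf Φ.scatteringSubspace z w - Φ.kernelOf (Φ.Smin i) z w :=
  Φ.kernelOf_inf_orthogonal (Φ.Smin_le i) (Φ.Smax_eq hij) z w

/-- `𝒦_Φ = S_1^min ⊕ S_2^min ⊕ ℛ` at the level of kernels. In this form the residual kernel is
symmetric in the two variables. -/
theorem residualKernel_eq (z w : bidisk) : Φ.residualKernel z w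
    = Φ.kernelOf Φ.scatteringSubspace z w - Φ.kernelOf (Φ.Smin 0) z w
      - Φ.kernelOf (Φ.Smin 1) z w := by
  have h : Φ.residualKernel z w = Φ.kernelOf (Φ.Smax 0) z w - Φ.kernelOf (Φ.Smin 0) z w :=
    Φ.kernelOf_inf_orthogonal (R := Φ.residual) (Φ.Smin_le_Smax 0) rfl z w
  rw [h, Φ.kernelOf_Smax one_ne_zero, sub_right_comm]

/-- The Agler decomposition of `Φ`, divided by `(1 - z₁ w̄₁)(1 - z₂ w̄₂)`. -/
theorem isAglerPair_iff {K₁ K₂ : bidisk → bidisk → (F →L[ℂ] F)} :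
    Φ.IsAglerPair K₁ K₂ ↔ IsPositiveKernel K₁ ∧ IsPositiveKernel K₂ ∧ ∀ z w,
      Φ.kernelOf Φ.scatteringSubspace z w
        = (1 - z.1 0 * (starRingEnd ℂ) (w.1 0))⁻¹ • K₁ z w
          + (1 - z.1 1 * (starRingEnd ℂ) (w.1 1))⁻¹ • K₂ z w := by
  have key : ∀ z w : bidisk, (ContinuousLinearMap.id ℂ F - Φ.toFun z ∘L (Φ.toFun w).adjoint
      = (1 - z.1 0 * (starRingEnd ℂ) (w.1 0)) • K₂ z w
        + (1 - z.1 1 * (starRingEnd ℂ) (w.1 1)) • K₁ z w) ↔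
      Φ.kernelOf Φ.scatteringSubspace z w
        = (1 - z.1 0 * (starRingEnd ℂ) (w.1 0))⁻¹ • K₁ z w
          + (1 - z.1 1 * (starRingEnd ℂ) (w.1 1))⁻¹ • K₂ z w := fun z w => by
    have h0 := one_sub_mul_conj_ne_zero z w 0
    have h1 := one_sub_mul_conj_ne_zero z w 1
    rw [Φ.kernelOf_scatteringSubspace, Fin.prod_univ_two]
    set a := 1 - z.1 0 * (starRingEnd ℂ) (w.1 0)
    set b := 1 - z.1 1 * (starRingEnd ℂ) (w.1 1)
    rw [← smul_right_inj (mul_ne_zero h0 h1) (m₁ := Φ.kernelOf Φ.scatteringSubspace z w), smul_add,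
      smul_smul, smul_smul, mul_comm a b, mul_inv_cancel_right₀ h0, mul_comm b a,
      mul_inv_cancel_right₀ h1, add_comm]
  exact ⟨fun h => ⟨h.1, h.2, fun z w => (key z w).1 (h.3 z w)⟩,
    fun h => ⟨h.1, h.2.1, fun z w => (key z w).2 (h.2.2 z w)⟩⟩

end SchurClass
end BidiskAgler
end

theorem mainTheorem1 {E F : Type*}
    [NormedAddCommGroup E] [InnerProductSpace ℂ E] [CompleteSpace E]
    [TopologicalSpace.SeparableSpace E]
    [NormedAddCommGroup F] [InnerProductSpace ℂ F] [CompleteSpace F]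
    [TopologicalSpace.SeparableSpace F]
    (Φ : BidiskAgler.SchurClass E F) :
    (∀ (j : Fin 2) (z w : BidiskAgler.bidisk),
      Φ.residualKernel z w
        = (1 - z.1 j * (starRingEnd ℂ) (w.1 j))⁻¹ • (Φ.Kmax j z w - Φ.Kmin j z w)) ∧
    ∀ K₁ K₂ : BidiskAgler.bidisk → BidiskAgler.bidisk → (F →L[ℂ] F),
      Φ.IsAglerPair K₁ K₂ ↔
        BidiskAgler.IsPositiveKernel K₁ ∧ BidiskAgler.IsPositiveKernel K₂ ∧
        ∃ G₁ G₂ : BidiskAgler.bidisk → BidiskAgler.bidisk → (F →L[ℂ] F),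
          BidiskAgler.IsPositiveKernel G₁ ∧ BidiskAgler.IsPositiveKernel G₂ ∧
          (∀ z w, K₁ z w
            = Φ.Kmin 0 z w + (1 - z.1 0 * (starRingEnd ℂ) (w.1 0)) • G₁ z w) ∧
          (∀ z w, K₂ z w
            = Φ.Kmin 1 z w + (1 - z.1 1 * (starRingEnd ℂ) (w.1 1)) • G₂ z w) ∧
          (∀ z w, Φ.residualKernel z w = G₁ z w + G₂ z w) := by
  have hne := BidiskAgler.one_sub_mul_conj_ne_zero
  refine ⟨fun j z w => ?_, fun K₁ K₂ => ?_⟩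
  · rw [Φ.Kmax_eq, Φ.Kmin_eq, ← smul_sub, smul_smul, inv_mul_cancel₀ (hne z w j), one_smul,
      Φ.residualKernel_eq]
    obtain rfl | rfl : j = 0 ∨ j = 1 := by omega
    · rw [Φ.kernelOf_Smax (i := 1) (j := 0) one_ne_zero, sub_right_comm]
    · rw [Φ.kernelOf_Smax (i := 0) (j := 1) zero_ne_one]
  rw [Φ.isAglerPair_iff]
  refine and_congr_right fun hK₁ => and_congr_right fun hK₂ => ⟨fun h => ?_, ?_⟩
  · have hA₁ := hK₁.inv_smul 0
    have hA₂ := hK₂.inv_smul 1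
    refine ⟨fun z w => (1 - z.1 0 * (starRingEnd ℂ) (w.1 0))⁻¹ • K₁ z w
        - Φ.kernelOf (Φ.Smin 0) z w,
      fun z w => (1 - z.1 1 * (starRingEnd ℂ) (w.1 1))⁻¹ • K₂ z w
        - Φ.kernelOf (Φ.Smin 1) z w, ?_, ?_, fun z w => ?_, fun z w => ?_, fun z w => ?_⟩
    -- the kernel of `𝒦_Φ` is `A₁ + A₂` and splits over `S_i^min` and `S_j^max`, so
    -- `A_i` dominates the former because `A_j` is dominated by the latter
    · convert! Φ.isPositiveKernel_kernelOf_Smax_sub zero_ne_one hA₂ ?_ ?_ using 3 with z w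
      · rw [Φ.kernelOf_Smax zero_ne_one, h]
        abel
      · convert! hK₂ using 3 with z w
        rw [smul_smul, mul_inv_cancel₀ (hne z w 1), one_smul]
      · convert! hA₁ using 3 with z w
        rw [h, add_sub_cancel_right]
    · convert! Φ.isPositiveKernel_kernelOf_Smax_sub one_ne_zero hA₁ ?_ ?_ using 3 with z w
      · rw [Φ.kernelOf_Smax one_ne_zero, h]
        abel
      · convert! hK₁ using 3 with z w
        rw [smul_smul, mul_inv_cancel₀ (hne z w 0), one_smul]
      · convert! hA₂ using 3 with z w
        rw [h, add_sub_cancel_left]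
    · rw [Φ.Kmin_eq, smul_sub, smul_smul, mul_inv_cancel₀ (hne z w 0), one_smul,
        add_sub_cancel]
    · rw [Φ.Kmin_eq, smul_sub, smul_smul, mul_inv_cancel₀ (hne z w 1), one_smul,
        add_sub_cancel]
    · rw [Φ.residualKernel_eq, h, sub_sub, add_sub_add_comm]
  · rintro ⟨G₁, G₂, -, -, h₁, h₂, hG⟩ z w
    have h := hG z w
    rw [Φ.residualKernel_eq, sub_sub, sub_eq_iff_eq_add] at h
    rw [h, h₁, h₂, Φ.Kmin_eq, Φ.Kmin_eq, ← smul_add, ← smul_add, smul_smul, smul_smul,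
      inv_mul_cancel₀ (hne z w 0), inv_mul_cancel₀ (hne z w 1), one_smul, one_smul]
    abel
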